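/- **Setting.** Let $q\in\mathbb C^\times$ not be a root of unity, $\lambda=q-q^{-1}$, and $[m]=\frac{q^m-q^{-m}}{q-q^{-1}}$. Let $S\subseteq\mathbb C$. For $n\ge 0$ let $\hat{\mathcal H}_n$ be the affine Hecke algebra, in which the inverses $(\tau_1-a)^{-1}$, $a\in S\cup\{0\}$, are adjoined (if $n\geq 1$): it is the unital associative $\mathbb C$-algebra generated by these inverses, by $\sigma_1,\dots,\sigma_{n-1}$ and by $\tau_1,\dots,\tau_n$, with the relations $\sigma_i\sigma_{i+1}\sigma_i=\sigma_{i+1}\sigma_i\sigma_{i+1}$, $\sigma_i\sigma_k=\sigma_k\sigma_i$ if $|i-k|>1$, $(\sigma_i-q)(\sigma_i+q^{-1})=0$, $\tau_{j+1}=\sigma_j\tau_j\sigma_j$, $\tau_l\tau_j=\tau_j\tau_l$, $\tau_j\sigma_i=\sigma_i\tau_j$ if $j\ne i,i+1$. (For $S=\emptyset$ this is the usual affine Hecke algebra, with invertible $\tau_j$; $\hat{\mathcal H}_0=\mathbb C$.) Elements of $\hat{\mathcal H}_n$ are also regarded as elements of $\hat{\mathcal H}_{n+1}$ through the natural homomorphism.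 Let $\mathrm{Tr}_{n+1}:\hat{\mathcal H}_{n+1}\to\hat{\mathcal H}_n$ ($n\ge0$) be linear maps (the partial traces of an Ocneanu–Markov trace) such that, for $X,X'\in\hat{\mathcal H}_n$, $Y\in\hat{\mathcal H}_{n+1}$, with constants $Q_0,Q_\pm,Q_\tau^{(l)}\in\mathbb C$, one has $\mathrm{Tr}_{n+1}(X)=Q_0X$, $\mathrm{Tr}_{n+1}(XYX')=X\,\mathrm{Tr}_{n+1}(Y)\,X'$, $\mathrm{Tr}_1(\tau_1^l)=Q_\tau^{(l)}$ ($l\in\mathbb Z$), and, for $n\ge1$, $\mathrm{Tr}_{n+1}(\sigma_n^{\pm1}X\sigma_n^{\mp1})=\mathrm{Tr}_n(X)$, $\mathrm{Tr}_{n+1}(X\sigma_n^{\pm1}X')=Q_\pm XX'$, $\mathrm{Tr}_n\mathrm{Tr}_{n+1}(\sigma_nY)=\mathrm{Tr}_n\mathrm{Tr}_{n+1}(Y\sigma_n)$. Assume $Q_+,Q_-\neq0$ and put $b=Q_+/Q_-$. Let $X_i(x)=\sigma_i+\frac{\lambda x}{1-x}$, and for $\xi\in\mathbb C$ let $$\tau_1(x)=\frac{\tau_1-\xi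 x}{\tau_1-\xi x^{-1}},\qquad \tau_{j+1}(x)=X_j(x)\,\tau_j(x)\,X_j(x).$$ Fix a sign $\pm$ and let $c_k=q^{\pm(2k-2)}$ be the quantum contents of the totally symmetric (one-row, sign $+$), respectively totally antisymmetric (one-column, sign $-$), tableau $m_\pm$ with $m$ nodes. Let $J_{1,j}=1$, $J_{i+1,j}=\sigma_{j+i-1}J_{i,j}\sigma_{j+i-1}$, and let $$A_j^{m_\pm}=\prod_{k=2}^m\frac{J_{k,j}-q^{\mp2}}{c_k-q^{\mp2}}$$ be the primitive idempotent of $m_\pm$. Put $$\bar B^{m_\pm}_j(x)=A^{m_\pm}_j\prod_{i=1,\dots,m}^{\rightarrow}\Big(X_{j+i-2}(x^2c_ic_1)\,X_{j+i-3}(x^2c_ic_2)\cdots X_j(x^2c_ic_{i-1})\;\tau_j(xc_i)\Big),$$ $$t_j^{m_\pm}(x)=\mathrm{Tr}_j\mathrm{Tr}_{j+1}\cdots\mathrm{Tr}_{j+m-1}\big(\bar B_j^{m_\pm}(x)\big),\qquad t_j^{m_\pm}(x\,|\,y)=\mathrm{Tr}_j\mathrm{Tr}_{j+1}\cdots\mathrm{Tr}_{j+m-1}\big(\bar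 B_j^{m_\pm}(x)\,\tau_j(y)\big),$$ which are elements of $\hat{\mathcal H}_{j-1}$, and $t^1_j(x)=\mathrm{Tr}_j(\tau_j(x))$. Write $[m]_\pm=[m]\big|_{q\to\pm q}$. **Theorem.** Let $m\ge2$, $j\ge1$ and $x\in\mathbb C^\times$, and suppose that $x$ is not at a pole, that is: $x^2c_ic_k\neq1$ for $1\le i<k\le m$; $xc_i\ne1$ for $1\le i\le m$ if $j\ge2$; and $\xi/(xc_i)\in S\cup\{0\}$ for $1\le i\le m$. Then $$t^{m_\pm}_{j}(x)=\frac1{[m]_\pm}\Big(t^{(m-1)_\pm}_{j}(x)\,t^1_j(xq^{\pm(2m-2)})+\eta^{m-1}_\pm(x)\,t^{(m-1)_\pm}_{j}(x\,|\,xq^{\pm(2m-2)})\Big),$$ where $$\eta_\pm^m(x)=Q_+\,\frac{q^m\,(q^2-q^{2m}x^2/b)\,[m]}{q^2-q^{4m}x^2}\;\Big|_{q\to\pm q^{\pm1}}$$ (the substitution acts on the displayed $q$, with $Q_+$ and $b$ kept fixed). -/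

import Mathlib

noncomputable section

namespace AffineHecke

/-- Generators of the affine Hecke algebra on `n` strands: `σ_i` for `1 ≤ i < n`, `τ_j` for
`1 ≤ j ≤ n`, and the inverses of `τ_1 - a` for `a = 0` and for `a ∈ S`.  (No generator is needed
for `σ_i⁻¹`: the quadratic relation makes `σ_i` invertible.) -/
inductive Gen (S : Set ℂ) (n : ℕ) : Type
  | sigma (i : ℕ) (h : 1 ≤ i ∧ i < n) : Gen S n
  | tau (j : ℕ) (h : 1 ≤ j ∧ j ≤ n) : Gen S n
  | res (a : ℂ) (h : 1 ≤ n ∧ (a = 0 ∨ a ∈ S)) : Gen S n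

/-- The word `σ_i` in the free algebra. -/
abbrev fSigma {S : Set ℂ} {n : ℕ} (i : ℕ) (h : 1 ≤ i ∧ i < n) : FreeAlgebra ℂ (Gen S n) :=
  FreeAlgebra.ι ℂ (Gen.sigma i h)

/-- The word `τ_j` in the free algebra. -/
abbrev fTau {S : Set ℂ} {n : ℕ} (j : ℕ) (h : 1 ≤ j ∧ j ≤ n) : FreeAlgebra ℂ (Gen S n) :=
  FreeAlgebra.ι ℂ (Gen.tau j h)

/-- The word `(τ_1 - a)⁻¹` in the free algebra. -/
abbrev fRes {S : Set ℂ} {n : ℕ} (a : ℂ) (h : 1 ≤ n ∧ (a = 0 ∨ a ∈ S)) :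
    FreeAlgebra ℂ (Gen S n) :=
  FreeAlgebra.ι ℂ (Gen.res a h)

/-- A scalar in the free algebra. -/
abbrev fC {S : Set ℂ} {n : ℕ} (z : ℂ) : FreeAlgebra ℂ (Gen S n) := algebraMap ℂ _ z

/-- The defining relations of the affine Hecke algebra on `n` strands. -/
inductive Rel (q : ℂ) (S : Set ℂ) (n : ℕ) :
    FreeAlgebra ℂ (Gen S n) → FreeAlgebra ℂ (Gen S n) → Prop
  | braid (i : ℕ) (h : 1 ≤ i ∧ i < n) (h' : 1 ≤ i + 1 ∧ i + 1 < n) :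
      Rel q S n (fSigma i h * fSigma (i + 1) h' * fSigma i h)
        (fSigma (i + 1) h' * fSigma i h * fSigma (i + 1) h')
  | far (i k : ℕ) (hi : 1 ≤ i ∧ i < n) (hk : 1 ≤ k ∧ k < n) (hik : i + 1 < k) :
      Rel q S n (fSigma i hi * fSigma k hk) (fSigma k hk * fSigma i hi)
  | quad (i : ℕ) (h : 1 ≤ i ∧ i < n) :
      Rel q S n ((fSigma i h - fC q) * (fSigma i h + fC q⁻¹)) 0
  | tauSucc (j : ℕ) (hs : 1 ≤ j ∧ j < n) (hj : 1 ≤ j ∧ j ≤ n) (hj' : 1 ≤ j + 1 ∧ j + 1 ≤ n) :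
      Rel q S n (fTau (j + 1) hj') (fSigma j hs * fTau j hj * fSigma j hs)
  | tauTau (j l : ℕ) (hj : 1 ≤ j ∧ j ≤ n) (hl : 1 ≤ l ∧ l ≤ n) :
      Rel q S n (fTau l hl * fTau j hj) (fTau j hj * fTau l hl)
  | tauSigma (j i : ℕ) (hj : 1 ≤ j ∧ j ≤ n) (hi : 1 ≤ i ∧ i < n) (h₁ : j ≠ i) (h₂ : j ≠ i + 1) :
      Rel q S n (fTau j hj * fSigma i hi) (fSigma i hi * fTau j hj)
  | resRight (a : ℂ) (h : 1 ≤ n ∧ (a = 0 ∨ a ∈ S)) (h1 : 1 ≤ 1 ∧ 1 ≤ n) :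
      Rel q S n ((fTau 1 h1 - fC a) * fRes a h) 1
  | resLeft (a : ℂ) (h : 1 ≤ n ∧ (a = 0 ∨ a ∈ S)) (h1 : 1 ≤ 1 ∧ 1 ≤ n) :
      Rel q S n (fRes a h * (fTau 1 h1 - fC a)) 1

/-- The affine Hecke algebra `Ĥ_n(q)`, in which `τ_1 - a` has been made invertible for `a ∈ S`
(so that the rational functions of `τ_1` with poles in `S` make sense); `τ_1` itself is always
invertible, and `S = ∅` gives the usual affine Hecke algebra.  `Ĥ_0 = ℂ`. -/
abbrev Alg (q : ℂ) (S : Set ℂ) (n : ℕ) : Type := RingQuot (Rel q S n)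

variable {q : ℂ} {S : Set ℂ}

/-- `σ_i ∈ Ĥ_n`, used only for `1 ≤ i < n`. -/
def sigma (q : ℂ) (S : Set ℂ) (n i : ℕ) : Alg q S n :=
  if h : 1 ≤ i ∧ i < n then RingQuot.mkAlgHom ℂ (Rel q S n) (fSigma i h) else 0

/-- `τ_j ∈ Ĥ_n`, used only for `1 ≤ j ≤ n`. -/
def tau (q : ℂ) (S : Set ℂ) (n j : ℕ) : Alg q S n :=
  if h : 1 ≤ j ∧ j ≤ n then RingQuot.mkAlgHom ℂ (Rel q S n) (fTau j h) else 0

/-- The images in `Ĥ_{n+1}` of the generators of `Ĥ_n`. -/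
def inclGen (q : ℂ) (S : Set ℂ) (n : ℕ) : Gen S n → Alg q S (n + 1)
  | .sigma i h => RingQuot.mkAlgHom ℂ (Rel q S (n + 1)) (fSigma i ⟨h.1, by omega⟩)
  | .tau j h => RingQuot.mkAlgHom ℂ (Rel q S (n + 1)) (fTau j ⟨h.1, by omega⟩)
  | .res a h => RingQuot.mkAlgHom ℂ (Rel q S (n + 1)) (fRes a ⟨by omega, h.2⟩)

theorem inclGen_rel (q : ℂ) (S : Set ℂ) (n : ℕ) ⦃x y : FreeAlgebra ℂ (Gen S n)⦄
    (h : Rel q S n x y) :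
    FreeAlgebra.lift ℂ (inclGen q S n) x = FreeAlgebra.lift ℂ (inclGen q S n) y := by
  have key : ∀ {u v : FreeAlgebra ℂ (Gen S (n + 1))}, Rel q S (n + 1) u v →
      RingQuot.mkAlgHom ℂ (Rel q S (n + 1)) u = RingQuot.mkAlgHom ℂ (Rel q S (n + 1)) v :=
    fun h => RingQuot.mkAlgHom_rel ℂ h
  cases h with
  | braid i h h' =>
    have := key (Rel.braid i ⟨h.1, by omega⟩ ⟨h'.1, by omega⟩)
    simpa [inclGen] using this
  | far i k hi hk hik =>
    have := key (Rel.far i k ⟨hi.1, by omega⟩ ⟨hk.1, by omega⟩ hik)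
    simpa [inclGen] using this
  | quad i h =>
    have := key (Rel.quad i ⟨h.1, by omega⟩)
    simpa [inclGen] using this
  | tauSucc j hs hj hj' =>
    have := key (Rel.tauSucc j ⟨hs.1, by omega⟩ ⟨hj.1, by omega⟩ ⟨hj'.1, by omega⟩)
    simpa [inclGen] using this
  | tauTau j l hj hl =>
    have := key (Rel.tauTau j l ⟨hj.1, by omega⟩ ⟨hl.1, by omega⟩)
    simpa [inclGen] using this
  | tauSigma j i hj hi h₁ h₂ =>
    have := key (Rel.tauSigma j i ⟨hj.1, by omega⟩ ⟨hi.1, by omega⟩ h₁ h₂)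
    simpa [inclGen] using this
  | resRight a h h1 =>
    have := key (Rel.resRight a ⟨by omega, h.2⟩ ⟨le_rfl, by omega⟩)
    simpa [inclGen] using this
  | resLeft a h h1 =>
    have := key (Rel.resLeft a ⟨by omega, h.2⟩ ⟨le_rfl, by omega⟩)
    simpa [inclGen] using this

/-- The natural homomorphism `Ĥ_n → Ĥ_{n+1}`, by which `Ĥ_n` is viewed inside `Ĥ_{n+1}`. -/
def incl (q : ℂ) (S : Set ℂ) (n : ℕ) : Alg q S n →ₐ[ℂ] Alg q S (n + 1) :=
  RingQuot.liftAlgHom ℂ ⟨FreeAlgebra.lift ℂ (inclGen q S n), inclGen_rel q S n⟩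

/-- A system of partial traces `Tr_{n+1} : Ĥ_{n+1} → Ĥ_n`, `n ≥ 0`, whose composition is the
Ocneanu--Markov trace, together with its parameters `Q_0`, `Q_±` and `Q_τ^{(l)}`. In the code
`tr n` is `Tr_{n+1}`. -/
structure MarkovTrace (q : ℂ) (S : Set ℂ) where
  Q0 : ℂ
  Qp : ℂ
  Qm : ℂ
  Qtau : ℤ → ℂ
  tr : (n : ℕ) → Alg q S (n + 1) →ₗ[ℂ] Alg q S n
  tr_incl : ∀ n (X : Alg q S n), tr n (incl q S n X) = Q0 • X
  tr_bimodule : ∀ n (X X' : Alg q S n) (Y : Alg q S (n + 1)),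
    tr n (incl q S n X * Y * incl q S n X') = X * tr n Y * X'
  tr_conj : ∀ n (X : Alg q S (n + 1)),
    tr (n + 1) (sigma q S (n + 2) (n + 1) * incl q S (n + 1) X *
      Ring.inverse (sigma q S (n + 2) (n + 1))) = incl q S n (tr n X)
  tr_conj_inv : ∀ n (X : Alg q S (n + 1)),
    tr (n + 1) (Ring.inverse (sigma q S (n + 2) (n + 1)) * incl q S (n + 1) X *
      sigma q S (n + 2) (n + 1)) = incl q S n (tr n X)
  tr_sigma : ∀ n (X X' : Alg q S (n + 1)),
    tr (n + 1) (incl q S (n + 1) X * sigma q S (n + 2) (n + 1) * incl q S (n + 1) X') =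
      Qp • (X * X')
  tr_sigma_inv : ∀ n (X X' : Alg q S (n + 1)),
    tr (n + 1) (incl q S (n + 1) X * Ring.inverse (sigma q S (n + 2) (n + 1)) *
      incl q S (n + 1) X') = Qm • (X * X')
  tr_tau_pow : ∀ l : ℕ, tr 0 (tau q S 1 1 ^ l) = algebraMap ℂ _ (Qtau l)
  tr_tau_inv_pow : ∀ l : ℕ, tr 0 (Ring.inverse (tau q S 1 1) ^ l) = algebraMap ℂ _ (Qtau (-l))
  tr_cyclic : ∀ n (Y : Alg q S (n + 2)),
    tr n (tr (n + 1) (sigma q S (n + 2) (n + 1) * Y)) =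
      tr n (tr (n + 1) (Y * sigma q S (n + 2) (n + 1)))

/-- `Tr_{k+1} Tr_{k+2} ⋯ Tr_{k+m} : Ĥ_{k+m} → Ĥ_k`. -/
def MarkovTrace.iter (T : MarkovTrace q S) (k : ℕ) : (m : ℕ) → Alg q S (k + m) →ₗ[ℂ] Alg q S k
  | 0 => LinearMap.id
  | m + 1 => (T.iter k m).comp (T.tr (k + m))

/-- The Baxterized element `X_i(x) = σ_i + (q - q⁻¹) x / (1 - x)` of `Ĥ_n`. -/
def baxX (q : ℂ) (S : Set ℂ) (n i : ℕ) (x : ℂ) : Alg q S n :=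
  sigma q S n i + algebraMap ℂ _ ((q - q⁻¹) * x / (1 - x))

/-- The Baxterized boundary elements of `Ĥ_n`: `τ_1(x) = (τ_1 - ξ x) / (τ_1 - ξ x⁻¹)` and
`τ_{j+1}(x) = X_j(x) τ_j(x) X_j(x)`. (The index `0` does not occur.) -/
def baxTau (q : ℂ) (S : Set ℂ) (ξ : ℂ) (n : ℕ) : ℕ → ℂ → Alg q S n
  | 0, _ => 1
  | 1, x => (tau q S n 1 - algebraMap ℂ _ (ξ * x)) *
      Ring.inverse (tau q S n 1 - algebraMap ℂ _ (ξ * x⁻¹))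
  | j + 2, x => baxX q S n (j + 1) x * baxTau q S ξ n (j + 1) x * baxX q S n (j + 1) x

/-- `X_{j+m-1}(x u_1) X_{j+m-2}(x u_2) ⋯ X_j(x u_m)`. -/
def baxXBack (q : ℂ) (S : Set ℂ) (n m j : ℕ) (x : ℂ) (u : ℕ → ℂ) : Alg q S n :=
  ((List.range m).map fun i => baxX q S n (j + m - 1 - i) (x * u (i + 1))).prod

/-- The fused boundary operator
`B_j(x) = ∏_{i = 1, …, m} (X_{j+i-2}(x² u_i u_1) ⋯ X_j(x² u_i u_{i-1})) τ_j(x u_i)`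
(factors in increasing order of `i` from left to right). -/
def fusedB (q : ℂ) (S : Set ℂ) (ξ : ℂ) (n m j : ℕ) (u : ℕ → ℂ) (x : ℂ) : Alg q S n :=
  ((List.range m).map fun i =>
    baxXBack q S n i j (x ^ 2 * u (i + 1)) u * baxTau q S ξ n j (x * u (i + 1))).prod

/-- The `j`-shifted Jucys--Murphy elements: `J_{1,j} = 1`,
`J_{i+1,j} = σ_{j+i-1} J_{i,j} σ_{j+i-1}`. (The index `i = 0` does not occur.) -/
def jucysMurphy (q : ℂ) (S : Set ℂ) (n j : ℕ) : ℕ → Alg q S n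
  | 0 => 1
  | 1 => 1
  | i + 2 => sigma q S n (j + i) * jucysMurphy q S n j (i + 1) * sigma q S n (j + i)

/-- The substitution `q ↦ ± q^{±1}`. The sign `s = 1` stands for the totally symmetric case and
`s = -1` for the totally antisymmetric one. -/
def sub (s : ℤˣ) (q : ℂ) : ℂ := ((s : ℤ) : ℂ) * q ^ (s : ℤ)

/-- The quantum contents `c_k = q^{±(2k-2)}` of the one-row (`s = 1`), respectively one-column
(`s = -1`), tableau. -/
def content (q : ℂ) (s : ℤˣ) (k : ℕ) : ℂ := q ^ ((s : ℤ) * (2 * (k : ℤ) - 2))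

/-- The primitive idempotent `A_j` of the one-row (`s = 1`) or one-column (`s = -1`) tableau with
`m` nodes, by its inductive definition through Jucys--Murphy elements: the tableau with `m - 1`
nodes has exactly two addable nodes, with contents `c_m = q^{±(2m-2)}` and `q^{∓2}`, whence
`A^{(m)} = A^{(m-1)} (J_m - q^{∓2}) / (c_m - q^{∓2})`. -/
def idem (q : ℂ) (S : Set ℂ) (s : ℤˣ) (n j : ℕ) : ℕ → Alg q S n
  | 0 => 1
  | 1 => 1
  | m + 2 => idem q S s n j (m + 1) *
      ((content q s (m + 2) - q ^ (-2 * (s : ℤ)))⁻¹ •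
        (jucysMurphy q S n j (m + 2) - algebraMap ℂ _ (q ^ (-2 * (s : ℤ)))))

/-- The projected fused boundary operator `B̄_j(x) = A_j B_j(x)` of the one-row or one-column
tableau with `m` nodes, as an element of `Ĥ_n`. -/
def barB (q : ℂ) (S : Set ℂ) (ξ : ℂ) (s : ℤˣ) (n m j : ℕ) (x : ℂ) : Alg q S n :=
  idem q S s n j m * fusedB q S ξ n m j (content q s) x

/-- The transfer matrix `Tr_j Tr_{j+1} ⋯ Tr_{j+m-1} (B̄_j(x)) ∈ Ĥ_{j-1}` of the one-row or
one-column tableau with `m` nodes, for `j ≥ 1`. For `m = 1` it is `Tr_j (τ_j(x))`. -/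
def transfer (T : MarkovTrace q S) (ξ : ℂ) (s : ℤˣ) (m j : ℕ) (x : ℂ) : Alg q S (j - 1) :=
  T.iter (j - 1) m (barB q S ξ s (j - 1 + m) m j x)

/-- The extended transfer matrix `Tr_j Tr_{j+1} ⋯ Tr_{j+m-1} (B̄_j(x) τ_j(y)) ∈ Ĥ_{j-1}`. -/
def transferExt (T : MarkovTrace q S) (ξ : ℂ) (s : ℤˣ) (m j : ℕ) (x y : ℂ) : Alg q S (j - 1) :=
  T.iter (j - 1) m (barB q S ξ s (j - 1 + m) m j x * baxTau q S ξ (j - 1 + m) j y)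

/-- The quantum integer `[m] = (q^m - q^{-m}) / (q - q⁻¹)`. -/
def qInt (q : ℂ) (m : ℕ) : ℂ := (q ^ m - (q ^ m)⁻¹) / (q - q⁻¹)

/-- `Q_+ q^m (q² - q^{2m} x² / b) [m] / (q² - q^{4m} x²)`. -/
def etaBase (Qp b q : ℂ) (m : ℕ) (x : ℂ) : ℂ :=
  Qp * (q ^ m * (q ^ 2 - q ^ (2 * m) * x ^ 2 / b) * qInt q m / (q ^ 2 - q ^ (4 * m) * x ^ 2))

/-- The rational function `η_±^m(x)`, with `b = Q_+ / Q_-`. -/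
def eta (T : MarkovTrace q S) (s : ℤˣ) (m : ℕ) (x : ℂ) : ℂ :=
  etaBase T.Qp (T.Qp / T.Qm) (sub s q) m x

end AffineHecke

end

/-! Put `α = sub s q`, which is `q` or `-q⁻¹`. Both are eigenvalues of every `σ_i`, and the contents
are even powers of `α`, so the symmetric and antisymmetric cases become a single argument about
elements that absorb generators, `W σ_i = α W`.

Let `W` be the projected fused operator on `m - 1` strands. The idempotent absorbs generators on
both sides. The fusion property `absorb_fusedProd`, a consequence of the Yang–Baxter and reflection
equations, carries right absorption past the fused product. The operator on `m` strands is `E W R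
t`, with `E` the symmetrizer on `m` strands, `R` a row of Baxterized generators and `t = τ_j(x
c_m)`. By `symmetrizer_succ`, `E W = [m]⁻¹ Σ W`, with `Σ` a sum over coset representatives.

Under the traces `R` can be replaced by the row of inverse generators plus a scalar
(`map_baxRow_sub`): a Baxterized generator is `σ_i⁻¹` plus a scalar, and every `σ_i⁻¹` except the
one next to `t` commutes with `t`, cycles round to `E` and is absorbed. In the inverse-row term, the
longest representative in `Σ` cycles round and conjugates `t` together with the inverse row. The
last partial trace of that conjugate is the image of `Tr_j(t)` (`tr_conj_row`), which gives the
product of transfer matrices. All remaining terms are scalars times the trace of `W t`, and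
`eta_scalar` sums them to `η`. The trace bookkeeping is `trace_symmetrizer_mul_baxRow`. -/

namespace AffineHecke

/-! ### Yang–Baxter equation, projectors, and the reflection equation at the first boundary element
-/

section Abstract

variable {R : Type*} [Ring R] [Algebra ℂ R]

/-- The Baxterization `s + (α - α⁻¹) x / (1 - x)` of an element `s`. -/
noncomputable def bax (α : ℂ) (s : R) (x : ℂ) : R := s + algebraMap ℂ R ((α - α⁻¹) * x / (1 - x))

theorem bax_eq_smul (α : ℂ) (s : R) (x : ℂ) :
    bax α s x = s + ((α - α⁻¹) * x / (1 - x)) • (1 : R) := by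
  rw [bax, Algebra.algebraMap_eq_smul_one]

/-- After the braid and quadratic relations the two sides differ only in the coefficients of `s` and
`t`, and both comparisons are the one condition `hc`. For nonzero scalars it says that `l (1/l +
1/f)` is multiplicative in the spectral parameter. -/
theorem yang_baxter_scalars {l f g h : ℂ} {s t : R} (hs : s * s = 1 + l • s)
    (ht : t * t = 1 + l • t) (hst : s * t * s = t * s * t) (hc : l * g + f * g + g * h = f * h) :
    (s + f • 1) * (t + g • 1) * (s + h • 1) = (t + h • 1) * (s + g • 1) * (t + f • (1 : R)) := by
  have e1 : (s + f • 1) * (t + g • 1) * (s + h • 1) =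
      s * t * s + h • (s * t) + g • (s * s) + (g * h) • s + f • (t * s) + (f * h) • t
        + (f * g) • s + (f * g * h) • (1 : R) := by
    simp only [mul_add, add_mul, smul_mul_assoc, mul_smul_comm, one_mul, mul_one, smul_smul,
      smul_add]
    module
  have e2 : (t + h • 1) * (s + g • 1) * (t + f • 1) =
      t * s * t + f • (t * s) + g • (t * t) + (g * f) • t + h • (s * t) + (f * h) • s
        + (h * g) • t + (f * g * h) • (1 : R) := by
    simp only [mul_add, add_mul, smul_mul_assoc, mul_smul_comm, one_mul, mul_one, smul_smul,
      smul_add]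
    module
  rw [e1, e2, hs, ht, hst, ← hc]
  module

theorem yang_baxter {α a b : ℂ} {s t : R} (hs : s * s = 1 + (α - α⁻¹) • s)
    (ht : t * t = 1 + (α - α⁻¹) • t) (hst : s * t * s = t * s * t) (ha : a ≠ 1) (hb : b ≠ 1)
    (hab : a * b ≠ 1) :
    bax α s a * bax α t (a * b) * bax α s b = bax α t b * bax α s (a * b) * bax α t a := by
  simp only [bax_eq_smul]
  refine yang_baxter_scalars hs ht hst ?_
  have h1 : 1 - a ≠ 0 := sub_ne_zero.2 ha.symm
  have h2 : 1 - b ≠ 0 := sub_ne_zero.2 hb.symm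
  have h3 : 1 - a * b ≠ 0 := sub_ne_zero.2 hab.symm
  generalize α - α⁻¹ = l
  field_simp
  ring

/-- At `α⁻²` the Baxterized generator degenerates to `α + α⁻¹` times the projector onto the
`α`-eigenspace of `s`. Inserting this projector is the mechanism of all the fusion arguments. -/
theorem bax_inv_sq {α : ℂ} (h0 : α ≠ 0) (h1 : α ^ 2 ≠ 1) (s : R) :
    bax α s (α ^ 2)⁻¹ = s + α⁻¹ • (1 : R) := by
  rw [bax_eq_smul]
  congr 2
  have : α ^ 2 - 1 ≠ 0 := sub_ne_zero.2 h1
  have : 1 - (α ^ 2)⁻¹ ≠ 0 := by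
    intro h
    apply h1
    rw [sub_eq_zero] at h
    exact (inv_eq_one.1 h.symm)
  field_simp

theorem bax_inv_sq_mul {α : ℂ} (h0 : α ≠ 0) (h1 : α ^ 2 ≠ 1) {s : R}
    (hs : s * s = 1 + (α - α⁻¹) • s) :
    bax α s (α ^ 2)⁻¹ * s = α • bax α s (α ^ 2)⁻¹ := by
  rw [bax_inv_sq h0 h1, add_mul, hs, smul_add, smul_smul, mul_inv_cancel₀ h0]
  simp only [smul_mul_assoc, one_mul]
  module

theorem mul_bax_inv_sq {α : ℂ} (h0 : α ≠ 0) (h1 : α ^ 2 ≠ 1) {s V : R} (hV : V * s = α • V) :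
    V * bax α s (α ^ 2)⁻¹ = (α + α⁻¹) • V := by
  rw [bax_inv_sq h0 h1, mul_add, hV, mul_smul_comm, mul_one, add_smul]

theorem add_inv_ne_zero {α : ℂ} (h0 : α ≠ 0) (h2 : α ^ 2 ≠ -1) : α + α⁻¹ ≠ 0 := by
  intro h
  apply h2
  field_simp at h
  linear_combination h

/-- If `V` absorbs `s` then `V X_t(a) X_s(α² a)` absorbs `t`. -/
theorem absorb_bax_bax {α a : ℂ} (h0 : α ≠ 0) (h1 : α ^ 2 ≠ 1) (h2 : α ^ 2 ≠ -1) {s t V : R}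
    (hs : s * s = 1 + (α - α⁻¹) • s) (ht : t * t = 1 + (α - α⁻¹) • t)
    (hst : s * t * s = t * s * t) (ha : a ≠ 1) (hb : a * α ^ 2 ≠ 1) (hV : V * s = α • V) :
    V * (bax α t a * bax α s (a * α ^ 2)) * t = α • (V * (bax α t a * bax α s (a * α ^ 2))) := by
  have h3 := add_inv_ne_zero h0 h2
  have hα : (α ^ 2)⁻¹ ≠ 1 := by simpa using h1
  have hp : (α ^ 2)⁻¹ * (a * α ^ 2) = a := by field_simp
  have key := yang_baxter hs ht hst hα hb (by rwa [hp])
  rw [hp] at key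
  -- Insert the projector `X_s(α⁻²)` next to `V`; Yang–Baxter moves it to the right end, where it
  -- becomes the projector for `t`.
  have hV' : V * (bax α t a * bax α s (a * α ^ 2)) =
      (α + α⁻¹)⁻¹ • (V * (bax α t (a * α ^ 2) * bax α s a) * bax α t (α ^ 2)⁻¹) := by
    rw [mul_assoc V _ (bax α t (α ^ 2)⁻¹), ← key, mul_assoc (bax α s _), ← mul_assoc V (bax α s _),
      mul_bax_inv_sq h0 h1 hV, smul_mul_assoc, smul_smul, inv_mul_cancel₀ h3, one_smul]
  rw [hV', smul_mul_assoc, mul_assoc _ _ t, bax_inv_sq_mul h0 h1 ht, mul_smul_comm, smul_comm]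

/-- The commutation relation between `T` and `s (T - c)⁻¹ s` in the affine Hecke algebra. -/
theorem comm_conj_resolvent {l c : ℂ} {s T P : R} (hs : s * s = 1 + l • s)
    (hT : s * T * s * T = T * s * T * s) (hP : (T - c • 1) * P = 1) (hP' : P * (T - c • 1) = 1) :
    T * (s * P * s) - s * P * s * T = l • (T * s * P - P * s * T) := by
  set p := T - c • (1 : R) with hp
  set s' := s - l • (1 : R) with hs'
  have i1 : s * s' = 1 := by
    rw [hs', mul_sub, hs, mul_smul_comm, mul_one]; abel
  have i2 : s' * s = 1 := by
    rw [hs', sub_mul, hs, smul_mul_assoc, one_mul]; abel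
  -- `P` commutes with `s T s`
  have hPu : P * (s * T * s) = s * T * s * P := by
    have c1 : p * (s * T * s) = s * T * s * p := by
      rw [hp, sub_mul, mul_sub]
      simp only [smul_mul_assoc, one_mul, mul_smul_comm, mul_one]
      rw [hT, ← mul_assoc, ← mul_assoc]
    calc P * (s * T * s) = P * (s * T * s * p) * P := by
          rw [mul_assoc P, mul_assoc (s * T * s), hP, mul_one]
      _ = _ := by rw [← c1, ← mul_assoc P, hP', one_mul]
  -- `[T, s P s'] = l [s, P] T`
  have hA : T * (s * p * s') - s * p * s' * T = -(l • ((T * s - s * T) * T)) := by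
    have : s * p * s' = s * T * s - l • (s * T) - c • 1 := by
      have e : s * p * s' = s * T * s' - c • (s * s') := by
        rw [hp, mul_sub s T, sub_mul _ _ s', mul_smul_comm, mul_one, smul_mul_assoc]
      rw [e, i1, hs', mul_sub, mul_smul_comm, mul_one]
    rw [this]
    simp only [mul_sub, sub_mul, mul_smul_comm, smul_mul_assoc, mul_one, one_mul]
    rw [hT]
    simp only [mul_assoc]
    module
  have hM1 : (s * P * s') * (s * p * s') = 1 := by
    calc _ = s * P * (s' * s) * p * s' := by simp only [mul_assoc]
      _ = _ := by rw [i2, mul_one, mul_assoc s, hP', mul_one, i1]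
  have hM2 : (s * p * s') * (s * P * s') = 1 := by
    calc _ = s * p * (s' * s) * P * s' := by simp only [mul_assoc]
      _ = _ := by rw [i2, mul_one, mul_assoc s, hP, mul_one, i1]
  -- With `M = s p s'` this is `[T, M⁻¹] = -M⁻¹ [T, M] M⁻¹`, and `hA` gives `[T, M]`.
  have hB : T * (s * P * s') - s * P * s' * T =
      -((s * P * s') * (T * (s * p * s') - s * p * s' * T) * (s * P * s')) := by
    have e1 : s * P * s' * (T * (s * p * s')) * (s * P * s') = s * P * s' * T := by
      rw [mul_assoc, mul_assoc T, hM2, mul_one]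
    have e2 : s * P * s' * (s * p * s' * T) * (s * P * s') = T * (s * P * s') := by
      rw [← mul_assoc (s * P * s'), hM1, one_mul]
    rw [mul_sub (s * P * s'), sub_mul _ _ (s * P * s'), e1, e2]; abel
  have hC : (s * P * s') * ((T * s - s * T) * T) * (s * P * s') = s * P * T - P * s * T := by
    have e0 : T * s - s * T = p * s - s * p := by
      rw [hp]; simp only [sub_mul, mul_sub, smul_mul_assoc, mul_smul_comm, one_mul, mul_one]; abel
    have e1 : s' * (p * s - s * p) = s' * p * s - p := by
      rw [mul_sub, ← mul_assoc, ← mul_assoc s' s, i2, one_mul]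
    calc (s * P * s') * ((T * s - s * T) * T) * (s * P * s')
        = s * P * (s' * (p * s - s * p)) * T * (s * P * s') := by
          rw [e0]; simp only [mul_assoc]
      _ = s * P * s' * (p * (s * T * s * P)) * s' - s * (P * p) * T * s * P * s' := by
          rw [e1]; simp only [mul_sub, sub_mul, mul_assoc]
      _ = s * P * (s' * s) * T * (s * s') - P * s * T * (s * s') := by
          rw [hP', mul_one, ← hPu, ← mul_assoc p, hP, one_mul]
          have : s * T * s * P * s' = P * (s * T * s) * s' := by rw [hPu]
          simp only [mul_assoc] at this ⊢
      _ = _ := by rw [i1, i2, mul_one, mul_one, mul_one]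
  have hD : T * (s * P * s') - s * P * s' * T = l • (s * P * T - P * s * T) := by
    rw [hB, hA, mul_neg, neg_mul, neg_neg, mul_smul_comm, smul_mul_assoc, hC]
  have hE : s * P * s = s * P * s' + l • (s * P) := by
    rw [hs', mul_sub, mul_smul_comm, mul_one]; abel
  rw [hE, mul_add, add_mul, mul_smul_comm, smul_mul_assoc]
  have : T * (s * P * s') = l • (s * P * T - P * s * T) + s * P * s' * T := by
    rw [← hD]; abel
  rw [this]
  simp only [mul_assoc]
  module

/-- The reflection equation for `(T - ξ u) / (T - ξ u⁻¹)`. -/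
theorem reflection_base {α u v ξ : ℂ} {s T P Q : R} (hu : u ≠ 0) (hv : v ≠ 0) (huv : u ≠ v)
    (huv1 : u * v ≠ 1) (hs : s * s = 1 + (α - α⁻¹) • s) (hT : s * T * s * T = T * s * T * s)
    (hP : (T - (ξ * u⁻¹) • 1) * P = 1) (hP' : P * (T - (ξ * u⁻¹) • 1) = 1)
    (hQ : (T - (ξ * v⁻¹) • 1) * Q = 1) (hQ' : Q * (T - (ξ * v⁻¹) • 1) = 1) :
    bax α s (u / v) * ((T - (ξ * u) • 1) * P) * bax α s (u * v) * ((T - (ξ * v) • 1) * Q) =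
      ((T - (ξ * v) • 1) * Q) * bax α s (u * v) * ((T - (ξ * u) • 1) * P) * bax α s (u / v) := by
  have key := comm_conj_resolvent hs hT hP hP'
  have hTP : (T - (ξ * u) • 1) * P = 1 + (ξ * u⁻¹ - ξ * u) • P := by
    rw [sub_mul, smul_mul_assoc, one_mul, sub_eq_iff_eq_add] at hP ⊢; rw [hP]; module
  have hTQ : (T - (ξ * v) • 1) * Q = 1 + (ξ * v⁻¹ - ξ * v) • Q := by
    rw [sub_mul, smul_mul_assoc, one_mul, sub_eq_iff_eq_add] at hQ ⊢; rw [hQ]; module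
  have eT : T * Q = 1 + (ξ * v⁻¹) • Q := by
    rw [← hQ]; simp only [sub_mul, smul_mul_assoc, one_mul]; module
  have eT' : Q * T = 1 + (ξ * v⁻¹) • Q := by
    rw [← hQ']; simp only [mul_sub, mul_smul_comm, mul_one]; module
  obtain ⟨a, ha⟩ : ∃ a, a = ξ * u⁻¹ - ξ * u := ⟨_, rfl⟩
  obtain ⟨b, hb⟩ : ∃ b, b = ξ * v⁻¹ - ξ * v := ⟨_, rfl⟩
  obtain ⟨d, hd⟩ : ∃ d, d = ξ * v⁻¹ := ⟨_, rfl⟩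
  obtain ⟨f, hf⟩ : ∃ f, f = (α - α⁻¹) * (u / v) / (1 - u / v) := ⟨_, rfl⟩
  obtain ⟨g, hg⟩ : ∃ g, g = (α - α⁻¹) * (u * v) / (1 - u * v) := ⟨_, rfl⟩
  rw [hTP, hTQ, bax_eq_smul, bax_eq_smul, ← ha, ← hb, ← hf, ← hg]
  rw [← hd] at eT eT'
  clear hTP hTQ
  generalize α - α⁻¹ = l at *
  -- The resolvent identity below divides by `ξ`; at `ξ = 0` both boundary factors are `1`.
  by_cases hξ : ξ = 0
  · subst hξ
    simp only [zero_mul, sub_self] at ha hb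
    simp only [ha, hb, zero_smul, add_zero, mul_one, one_mul, mul_add, add_mul,
      smul_mul_assoc, mul_smul_comm]
    module
  have hvu : v - u ≠ 0 := sub_ne_zero.2 huv.symm
  have h1uv : 1 - u * v ≠ 0 := sub_ne_zero.2 huv1.symm
  have h1vu : 1 - v * u ≠ 0 := by rwa [mul_comm]
  have hf' : f = l * u / (v - u) := by
    rw [hf]
    have : 1 - u / v ≠ 0 := by
      intro h
      apply hvu
      field_simp at h
      rw [h, mul_zero]
    field_simp
  have h1 : u * v / (ξ * (v - u)) * (ξ * u⁻¹ - ξ * v⁻¹) = 1 := by field_simp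
  -- The constant of the resolvent identity `P Q = e (P - Q)`.
  obtain ⟨e, he⟩ : ∃ e, e = u * v / (ξ * (v - u)) := ⟨_, rfl⟩
  rw [← he] at h1
  have res1 : P * Q = e • (P - Q) := by
    have : P - Q = (ξ * u⁻¹ - ξ * v⁻¹) • (P * Q) := by
      calc P - Q = P * ((T - (ξ * v⁻¹) • 1) * Q) - P * (T - (ξ * u⁻¹) • 1) * Q := by
            rw [hQ, hP', mul_one, one_mul]
        _ = _ := by
            simp only [mul_sub, sub_mul, mul_smul_comm, smul_mul_assoc, one_mul, mul_one, mul_assoc]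
            module
    rw [this, smul_smul, h1, one_smul]
  have res2 : Q * P = e • (P - Q) := by
    have : P - Q = (ξ * u⁻¹ - ξ * v⁻¹) • (Q * P) := by
      calc P - Q = Q * (T - (ξ * v⁻¹) • 1) * P - Q * ((T - (ξ * u⁻¹) • 1) * P) := by
            rw [hP, hQ', mul_one, one_mul]
        _ = _ := by
            simp only [mul_sub, sub_mul, mul_smul_comm, smul_mul_assoc, one_mul, mul_one, mul_assoc]
            module
    rw [this, smul_smul, h1, one_smul]
  -- Sandwiching `key` between two copies of `Q` eliminates the bare `T`, because `T Q = Q T = 1 + d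
  -- Q`.
  have comm : s * P * s * Q - Q * s * P * s = l • (s * (P * Q) - (Q * P) * s
      + d • (Q * s * (P * Q) - (Q * P) * s * Q)) := by
    have e1 : s * P * s * Q - Q * s * P * s =
        Q * (T * (s * P * s) - s * P * s * T) * Q := by
      have : Q * (T * (s * P * s) - s * P * s * T) * Q =
        (Q * T) * (s * P * s) * Q - Q * (s * P * s) * (T * Q) := by
          simp only [mul_sub, sub_mul, mul_assoc]
      rw [this, eT, eT']
      simp only [mul_add, add_mul, mul_smul_comm, smul_mul_assoc, mul_one, one_mul, mul_assoc]
      abel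
    have e2 : Q * (T * s * P - P * s * T) * Q =
        (Q * T) * s * (P * Q) - (Q * P) * s * (T * Q) := by
      simp only [mul_sub, sub_mul, mul_assoc]
    rw [e1, key, mul_smul_comm, smul_mul_assoc, e2, eT, eT']
    simp only [mul_add, add_mul, mul_smul_comm, smul_mul_assoc, mul_one, one_mul, mul_assoc]
    module
  rw [res1, res2, sub_eq_iff_eq_add] at comm
  simp only [mul_sub, sub_mul, mul_smul_comm, smul_mul_assoc, mul_assoc] at comm
  have hs2 : s * (s * Q) = Q + l • (s * Q) := by
    rw [← mul_assoc, hs, add_mul, one_mul, smul_mul_assoc]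
  simp only [mul_add, add_mul, mul_smul_comm, smul_mul_assoc, mul_one, one_mul, mul_assoc]
  have res3 : Q * (P * s) = e • (P * s - Q * s) := by
    rw [← mul_assoc, res2, smul_mul_assoc, sub_mul]
  rw [comm, res1, res2, res3, hs, hs2]
  simp only [mul_add, mul_sub, mul_smul_comm, mul_one]
  match_scalars <;>
    first | ring1 | (simp only [ha, hb, hf', hg, he, hd]; field_simp; try ring1)

end Abstract

/-! ### Induction step for the reflection equation, and fusion -/

section Abstract

variable {R : Type*} [Ring R] [Algebra ℂ R]

theorem commute_bax {α x : ℂ} {s r : R} (h : Commute r s) : Commute r (bax α s x) :=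
  h.add_right (Algebra.commutes _ _).symm

/-- The reflection equation is inherited by `X_s(x) τ(x) X_s(x)`. -/
theorem reflection_step {α u v : ℂ} {s t A B : R} (hu : u ≠ 1) (hv : v ≠ 1) (hv0 : v ≠ 0)
    (huv : u ≠ v) (huv1 : u * v ≠ 1) (hs : s * s = 1 + (α - α⁻¹) • s)
    (ht : t * t = 1 + (α - α⁻¹) • t) (hst : s * t * s = t * s * t) (hA : Commute t A)
    (hB : Commute t B)
    (h : bax α s (u / v) * A * bax α s (u * v) * B = B * bax α s (u * v) * A * bax α s (u / v)) :
    bax α t (u / v) * (bax α s u * A * bax α s u) * bax α t (u * v) *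
        (bax α s v * B * bax α s v) =
      (bax α s v * B * bax α s v) * bax α t (u * v) * (bax α s u * A * bax α s u) *
        bax α t (u / v) := by
  have hd : u / v ≠ 1 := fun h => huv (by field_simp at h; exact h)
  have huv' : u / v * v = u := by field_simp
  have y1 := yang_baxter hs ht hst hu hv huv1
  have y1' := yang_baxter hs ht hst hv hu (by rwa [mul_comm])
  rw [mul_comm v u] at y1'
  have y2 := yang_baxter ht hs hst.symm hd hv (by rwa [huv'])
  have y2' := yang_baxter ht hs hst.symm hv hd (by rwa [mul_comm, huv'])
  rw [huv'] at y2
  rw [mul_comm v, huv'] at y2'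
  have cA : ∀ x, bax α t x * A = A * bax α t x := fun x => (commute_bax hA.symm).eq.symm
  have cB : ∀ x, bax α t x * B = B * bax α t x := fun x => (commute_bax hB.symm).eq.symm
  -- Two Yang–Baxter moves, with `t` commuting past `A` and `B`, expose one side of `h`; the
  -- mirrored moves then restore the outer factors.
  calc bax α t (u / v) * (bax α s u * A * bax α s u) * bax α t (u * v) *
        (bax α s v * B * bax α s v)
      = bax α t (u / v) * bax α s u * A * (bax α s u * bax α t (u * v) * bax α s v) * B *
          bax α s v := by simp only [mul_assoc]
    _ = bax α t (u / v) * bax α s u * (A * bax α t v) * bax α s (u * v) * (bax α t u * B) *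
          bax α s v := by rw [y1]; simp only [mul_assoc]
    _ = (bax α t (u / v) * bax α s u * bax α t v) * A * bax α s (u * v) * B * bax α t u *
          bax α s v := by rw [← cA, cB]; simp only [mul_assoc]
    _ = bax α s v * bax α t u * (bax α s (u / v) * A * bax α s (u * v) * B) * bax α t u *
          bax α s v := by rw [y2]; simp only [mul_assoc]
    _ = bax α s v * (bax α t u * B) * bax α s (u * v) * A * (bax α s (u / v) * bax α t u *
          bax α s v) := by rw [h]; simp only [mul_assoc]
    _ = bax α s v * B * bax α t u * bax α s (u * v) * (A * bax α t v) * bax α s u *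
          bax α t (u / v) := by rw [cB, ← y2']; simp only [mul_assoc]
    _ = bax α s v * B * (bax α t u * bax α s (u * v) * bax α t v) * A * bax α s u *
          bax α t (u / v) := by rw [← cA]; simp only [mul_assoc]
    _ = _ := by rw [← y1']; simp only [mul_assoc]

/-- `σ_0, …, σ_{N-1}` satisfy the relations of the finite Hecke algebra, with eigenvalues `α` and
`-α⁻¹`. -/
structure IsHeckeSeq (α : ℂ) (N : ℕ) (σ : ℕ → R) : Prop where
  quad : ∀ i < N, σ i * σ i = 1 + (α - α⁻¹) • σ i
  braid : ∀ i, i + 1 < N → σ i * σ (i + 1) * σ i = σ (i + 1) * σ i * σ (i + 1)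
  comm : ∀ i k, i + 1 < k → k < N → Commute (σ i) (σ k)

namespace IsHeckeSeq

variable {α : ℂ} {N : ℕ} {σ : ℕ → R}

theorem mono (h : IsHeckeSeq α N σ) {M : ℕ} (hM : M ≤ N) : IsHeckeSeq α M σ :=
  ⟨fun i hi => h.quad i (by omega), fun i hi => h.braid i (by omega),
    fun i k hi hk => h.comm i k hi (by omega)⟩

theorem op (h : IsHeckeSeq α N σ) : IsHeckeSeq α N fun i => MulOpposite.op (σ i) :=
  ⟨fun i hi => by rw [← MulOpposite.op_mul, h.quad i hi]; rfl,
    fun i hi => by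
      simp only [← MulOpposite.op_mul, ← mul_assoc]
      rw [h.braid i hi],
    fun i k hi hk => (h.comm i k hi hk).op⟩

end IsHeckeSeq

/-- `X_{m-1}(z) X_{m-2}(z α²) ⋯ X_0(z α^{2m-2})`. -/
noncomputable def baxRow (α : ℂ) (σ : ℕ → R) : ℕ → ℂ → R
  | 0, _ => 1
  | m + 1, z => bax α (σ m) z * baxRow α σ m (z * α ^ 2)

theorem baxRow_succ_right (α : ℂ) (σ : ℕ → R) (m : ℕ) (z : ℂ) :
    baxRow α σ (m + 1) z =
      baxRow α (fun i => σ (i + 1)) m z * bax α (σ 0) (z * α ^ (2 * m)) := by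
  induction m generalizing z with
  | zero => simp [baxRow]
  | succ m ih =>
    rw [baxRow, ih, baxRow, mul_assoc (bax α _ z),
      show z * α ^ 2 * α ^ (2 * m) = z * α ^ (2 * (m + 1)) by ring]

theorem commute_baxRow {α : ℂ} {σ : ℕ → R} {m : ℕ} {r : R} (h : ∀ i < m, Commute r (σ i)) (z : ℂ) :
    Commute r (baxRow α σ m z) := by
  induction m generalizing z with
  | zero => exact Commute.one_right _
  | succ m ih =>
    exact (commute_bax (h m (by omega))).mul_right (ih (fun i hi => h i (by omega)) _)

theorem absorb_commute {α : ℂ} {s r V : R} (h : Commute r s) (hV : V * s = α • V) :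
    V * r * s = α • (V * r) := by
  rw [mul_assoc, h.eq, ← mul_assoc, hV, smul_mul_assoc]

/-- Passing the adjacent pair `X_{i+1} X_i` of the row raises the absorbed index from `i` to `i +
1`; factors before the pair commute with `σ i`, and those after it with `σ (i + 1)`. -/
theorem absorb_baxRow {α : ℂ} (h0 : α ≠ 0) (h1 : α ^ 2 ≠ 1) (h2 : α ^ 2 ≠ -1) {N : ℕ} {σ : ℕ → R}
    (hσ : IsHeckeSeq α N σ) {m : ℕ} (hm : m ≤ N) {i : ℕ} (hi : i + 1 < m) {V : R}
    (hV : V * σ i = α • V) {z : ℂ} (hz : ∀ k < m, z * α ^ (2 * k) ≠ 1) :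
    V * baxRow α σ m z * σ (i + 1) = α • (V * baxRow α σ m z) := by
  induction m generalizing z V with
  | zero => omega
  | succ m ih =>
    have hz' : ∀ k < m, z * α ^ 2 * α ^ (2 * k) ≠ 1 := fun k hk => by
      have := hz (k + 1) (by omega)
      rwa [mul_add, pow_add, mul_comm (α ^ (2 * k)), ← mul_assoc] at this
    rcases Nat.lt_succ_iff_lt_or_eq.1 hi with hi | rfl
    · rw [baxRow, ← mul_assoc]
      exact ih (by omega) hi
        (absorb_commute (commute_bax (hσ.comm i m hi (by omega))).symm hV) hz'
    · rw [baxRow, baxRow, ← mul_assoc (bax α _ _), ← mul_assoc V]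
      refine absorb_commute (commute_baxRow (fun k hk => ?_) _).symm ?_
      · exact (hσ.comm k (i + 1) (by omega) (by omega)).symm
      · exact absorb_bax_bax h0 h1 h2 (hσ.quad _ (by omega)) (hσ.quad _ (by omega))
          (hσ.braid _ (by omega)) (by simpa using hz 0 (by omega))
          (by simpa using hz' 0 (by omega)) hV

/-- The two rows interleave into adjacent pairs `X_k X_{k+1}`, each of which lowers the absorbed
index by one, until it reaches `0`. -/
theorem absorb_baxRow_baxRow {α : ℂ} (h0 : α ≠ 0) (h1 : α ^ 2 ≠ 1) (h2 : α ^ 2 ≠ -1) {N : ℕ}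
    {σ : ℕ → R} (hσ : IsHeckeSeq α N σ) {p : ℕ} (hp : p < N) {V : R} (hV : V * σ p = α • V) {a : ℂ}
    (ha : ∀ k < p, a * α ^ (2 * k) ≠ 1) (ha' : ∀ k < p, a * α ^ 2 * α ^ (2 * k) ≠ 1) :
    V * (baxRow α σ p a * baxRow α (fun i => σ (i + 1)) p (a * α ^ 2)) * σ 0 =
      α • (V * (baxRow α σ p a * baxRow α (fun i => σ (i + 1)) p (a * α ^ 2))) := by
  induction p generalizing a V with
  | zero => simpa [baxRow] using hV
  | succ p ih =>
    have shift : ∀ b : ℂ, ∀ k, b * α ^ 2 * α ^ (2 * k) = b * α ^ (2 * (k + 1)) := fun b k => by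
      ring
    have e : baxRow α σ (p + 1) a * baxRow α (fun i => σ (i + 1)) (p + 1) (a * α ^ 2) =
        (bax α (σ p) a * bax α (σ (p + 1)) (a * α ^ 2)) * (baxRow α σ p (a * α ^ 2) *
          baxRow α (fun i => σ (i + 1)) p (a * α ^ 2 * α ^ 2)) := by
      have c : Commute (bax α (σ (p + 1)) (a * α ^ 2)) (baxRow α σ p (a * α ^ 2)) :=
        commute_baxRow (fun k hk => (commute_bax (hσ.comm k (p + 1) (by omega) hp)).symm) _
      rw [baxRow, baxRow, mul_assoc, ← mul_assoc (baxRow α σ p _), ← c.eq]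
      simp only [mul_assoc]
    rw [e, ← mul_assoc V]
    refine ih (by omega) ?_ (fun k hk => ?_) fun k hk => ?_
    · exact absorb_bax_bax h0 h1 h2 (hσ.quad _ (by omega)) (hσ.quad _ (by omega))
        (hσ.braid _ (by omega)).symm (by simpa using ha 0 (by omega))
        (by simpa using ha' 0 (by omega)) hV
    · rw [shift]; exact ha (k + 1) (by omega)
    · rw [shift]; exact ha' (k + 1) (by omega)

/-- `∏_{i < m} (X_{i-1}(x² α^{2i}) ⋯ X_0(x² α^{2i} α^{2i-2})) τ(x α^{2i})`. -/
noncomputable def fusedProd (α : ℂ) (σ : ℕ → R) (τ : ℂ → R) (x : ℂ) : ℕ → R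
  | 0 => 1
  | m + 1 => fusedProd α σ τ x m *
      (baxRow α σ m (x ^ 2 * α ^ (2 * m)) * τ (x * α ^ (2 * m)))

theorem commute_fusedProd {α x : ℂ} {σ : ℕ → R} {τ : ℂ → R} {m : ℕ} {r : R}
    (h : ∀ i, i + 1 < m → Commute r (σ i)) (hτ : ∀ i < m, Commute r (τ (x * α ^ (2 * i)))) :
    Commute r (fusedProd α σ τ x m) := by
  induction m with
  | zero => exact Commute.one_right _
  | succ m ih =>
    exact (ih (fun i hi => h i (by omega)) fun i hi => hτ i (by omega)).mul_right
      ((commute_baxRow (fun i hi => h i (by omega)) _).mul_right (hτ m (by omega)))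

/-- The fusion property: an absorbing element stays absorbing after multiplication by the fused
boundary operator. -/
theorem absorb_fusedProd {α : ℂ} (h0 : α ≠ 0) (h1 : α ^ 2 ≠ 1) (h2 : α ^ 2 ≠ -1) {m : ℕ}
    {σ : ℕ → R} (hσ : IsHeckeSeq α (m - 1) σ) {τ : ℂ → R} {x : ℂ} (hx : x ≠ 0)
    (hpole : ∀ i k, k < i → i < m → x ^ 2 * α ^ (2 * i) * α ^ (2 * k) ≠ 1)
    (hτ : ∀ i < m, ∀ k, 1 ≤ k → k + 1 < m → Commute (σ k) (τ (x * α ^ (2 * i))))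
    (hrefl : ∀ i, i + 1 < m →
      bax α (σ 0) (x * α ^ (2 * i) / (x * α ^ (2 * (i + 1)))) * τ (x * α ^ (2 * i)) *
        bax α (σ 0) (x * α ^ (2 * i) * (x * α ^ (2 * (i + 1)))) * τ (x * α ^ (2 * (i + 1))) =
      τ (x * α ^ (2 * (i + 1))) * bax α (σ 0) (x * α ^ (2 * i) * (x * α ^ (2 * (i + 1)))) *
        τ (x * α ^ (2 * i)) * bax α (σ 0) (x * α ^ (2 * i) / (x * α ^ (2 * (i + 1)))))
    {Z : R} (hZ : ∀ i, i + 1 < m → Z * σ i = α • Z) {i : ℕ} (hi : i + 1 < m) :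
    Z * fusedProd α σ τ x m * σ i = α • (Z * fusedProd α σ τ x m) := by
  induction m generalizing i with
  | zero => omega
  | succ m ih =>
    have row : ∀ k < m, x ^ 2 * α ^ (2 * m) * α ^ (2 * k) ≠ 1 := fun k hk =>
      hpole m k hk (by omega)
    obtain ⟨p, rfl⟩ : ∃ p, m = p + 1 := ⟨m - 1, by omega⟩
    rcases Nat.eq_zero_or_pos i with rfl | hi0
    -- `σ p` commutes with the first `p` blocks, so the partial product still absorbs it; the last
    -- two rows then carry this absorption down to `σ 0`.
    · have hV : Z * fusedProd α σ τ x p * σ p = α • (Z * fusedProd α σ τ x p) := by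
        refine absorb_commute ?_ (hZ p (by omega))
        refine (commute_fusedProd (fun k hk => ?_) fun k hk => ?_).symm
        · exact (hσ.comm k p (by omega) (by omega)).symm
        · exact hτ k (by omega) p (by omega) (by omega)
      have e1 : x ^ 2 * α ^ (2 * (p + 1)) = x ^ 2 * α ^ (2 * p) * α ^ 2 := by ring
      have e2 : x ^ 2 * α ^ (2 * (p + 1)) * α ^ (2 * p) =
        x * α ^ (2 * p) * (x * α ^ (2 * (p + 1))) := by ring
      have e3 : x * α ^ (2 * p) / (x * α ^ (2 * (p + 1))) = (α ^ 2)⁻¹ := by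
        rw [mul_add, pow_add]; field_simp
      have hr := hrefl p (by omega)
      rw [e3] at hr
      set t₁ := τ (x * α ^ (2 * p)) with ht₁
      set t₂ := τ (x * α ^ (2 * (p + 1))) with ht₂
      set w := x * α ^ (2 * p) * (x * α ^ (2 * (p + 1))) with hw
      set s := σ 0 with hs
      have two := absorb_baxRow_baxRow h0 h1 h2 hσ (p := p) (by omega) hV
        (a := x ^ 2 * α ^ (2 * p)) (fun k hk => hpole p k hk (by omega))
        (fun k hk => by rw [← e1]; exact row k (by omega))
      rw [← e1] at two
      set U := Z * fusedProd α σ τ x p * (baxRow α σ p (x ^ 2 * α ^ (2 * p)) *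
        baxRow α (fun i => σ (i + 1)) p (x ^ 2 * α ^ (2 * (p + 1)))) with hU
      have ct : Commute t₁ (baxRow α (fun i => σ (i + 1)) p (x ^ 2 * α ^ (2 * (p + 1)))) :=
        commute_baxRow (fun k hk => (hτ p (by omega) (k + 1) (by omega) (by omega)).symm) _
      have e : Z * fusedProd α σ τ x (p + 1 + 1) = U * (t₁ * bax α s w * t₂) := by
        rw [fusedProd, fusedProd, baxRow_succ_right, e2, ← ht₁, ← ht₂, ← hs, hU]
        simp only [mul_assoc]
        rw [← mul_assoc t₁, ct.eq]
        simp only [mul_assoc]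
      have h3 := add_inv_ne_zero h0 h2
      -- `U` absorbs `s`, so the projector `X_s(α⁻²)` can be inserted after it; the reflection
      -- equation moves it to the right end and exchanges `t₁` and `t₂`.
      have e' : U * (t₁ * bax α s w * t₂) =
          (α + α⁻¹)⁻¹ • (U * (t₂ * bax α s w * t₁) * bax α s (α ^ 2)⁻¹) := by
        have : U * (t₂ * bax α s w * t₁) * bax α s (α ^ 2)⁻¹ =
            (U * bax α s (α ^ 2)⁻¹) * (t₁ * bax α s w * t₂) := by
          rw [mul_assoc U, ← hr]; simp only [mul_assoc]
        rw [this, mul_bax_inv_sq h0 h1 two, smul_mul_assoc, smul_smul, inv_mul_cancel₀ h3,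
          one_smul]
      rw [e, e', smul_mul_assoc, mul_assoc _ _ s, bax_inv_sq_mul h0 h1 (hσ.quad 0 (by omega)),
        mul_smul_comm, smul_comm]
    · obtain ⟨i, rfl⟩ : ∃ k, i = k + 1 := ⟨i - 1, by omega⟩
      rw [fusedProd, ← mul_assoc, ← mul_assoc]
      refine absorb_commute (hτ (p + 1) (by omega) (i + 1) (by omega) (by omega)).symm ?_
      refine absorb_baxRow h0 h1 h2 hσ (by omega) (by omega) ?_ row
      exact ih (hσ.mono (by omega)) (fun i k hk hi => hpole i k hk (by omega))
        (fun i hi k hk hk' => hτ i (by omega) k hk (by omega)) (fun k hk => hrefl k (by omega))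
        (fun k hk => hZ k (by omega)) (by omega)

end Abstract

/-! ### Symmetrizers, Jucys–Murphy elements and coset sums -/

section Abstract

variable {R : Type*} [Ring R] [Algebra ℂ R]

/-- The sum `∑_k α^{-k} σ_k ⋯ σ_{m-1}` over coset representatives. -/
noncomputable def cosetSum (α : ℂ) (σ : ℕ → R) : ℕ → R
  | 0 => 1
  | m + 1 => cosetSum α σ m * σ m + (α ^ (m + 1))⁻¹ • (1 : R)

/-- The Jucys--Murphy elements `σ_{m-1} ⋯ σ_0 σ_0 ⋯ σ_{m-1}`. -/
def jmElt (σ : ℕ → R) : ℕ → R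
  | 0 => 1
  | m + 1 => σ m * jmElt σ m * σ m

/-- The symmetrizer on `m + 1` strands, as a product over Jucys--Murphy elements. -/
noncomputable def symmetrizer (α : ℂ) (σ : ℕ → R) : ℕ → R
  | 0 => 1
  | m + 1 => symmetrizer α σ m *
      ((α ^ (2 * (m + 1)) - (α ^ 2)⁻¹)⁻¹ • (jmElt σ (m + 1) - (α ^ 2)⁻¹ • (1 : R)))

theorem commute_cosetSum {α : ℂ} {σ : ℕ → R} {m : ℕ} {r : R} (h : ∀ i < m, Commute r (σ i)) :
    Commute r (cosetSum α σ m) := by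
  induction m with
  | zero => exact Commute.one_right _
  | succ m ih =>
    exact ((ih fun i hi => h i (by omega)).mul_right (h m (by omega))).add_right
      ((Commute.one_right _).smul_right _)

theorem commute_jmElt {R : Type*} [Ring R] {σ : ℕ → R} {m : ℕ} {r : R} (h : ∀ i < m, Commute r (σ i)) :
    Commute r (jmElt σ m) := by
  induction m with
  | zero => exact Commute.one_right _
  | succ m ih =>
    exact ((h m (by omega)).mul_right (ih fun i hi => h i (by omega))).mul_right (h m (by omega))

theorem commute_symmetrizer {α : ℂ} {σ : ℕ → R} {m : ℕ} {r : R} (h : ∀ i < m, Commute r (σ i)) :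
    Commute r (symmetrizer α σ m) := by
  induction m with
  | zero => exact Commute.one_right _
  | succ m ih =>
    exact (ih fun i hi => h i (by omega)).mul_right
      (((commute_jmElt h).sub_right ((Commute.one_right _).smul_right _)).smul_right _)

theorem jmElt_op {R : Type*} [Ring R] (σ : ℕ → R) (m : ℕ) :
    jmElt (fun i => MulOpposite.op (σ i)) m = MulOpposite.op (jmElt σ m) := by
  induction m with
  | zero => rfl
  | succ m ih => simp only [jmElt, ih, ← MulOpposite.op_mul, mul_assoc]

section

variable {α : ℂ} {N : ℕ} {σ : ℕ → R}

theorem sigma_mul_absorb (hσ : IsHeckeSeq α N σ) {m : ℕ} (hm : m < N) {W : R}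
    (hW : ∀ i < m, σ i * W = α • W) {i : ℕ} (hi : i + 1 < m) :
    σ i * (σ m * W) = α • (σ m * W) := by
  rw [← mul_assoc, (hσ.comm i m hi hm).eq, mul_assoc, hW i (by omega), mul_smul_comm]

/-- On all summands but the last, a braid move turns the outer `σ m` into `σ (m - 1)`, which `W`
absorbs. The quadratic relation on the last summand produces the two correction terms. -/
theorem sigma_cosetSum_sigma (h0 : α ≠ 0) (hσ : IsHeckeSeq α N σ) {m : ℕ} (hm : m < N) {W : R}
    (hW : ∀ i < m, σ i * W = α • W) :
    σ m * (cosetSum α σ m * (σ m * W)) =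
      α • (cosetSum α σ m * (σ m * W)) + (α ^ m)⁻¹ • W - (α ^ (m + 1))⁻¹ • (σ m * W) := by
  cases m with
  | zero =>
    simp only [cosetSum, one_mul]
    rw [← mul_assoc, hσ.quad 0 hm, add_mul, one_mul, smul_mul_assoc]
    simp only [pow_zero, inv_one, zero_add, pow_one]
    module
  | succ m =>
    have c : Commute (σ (m + 1)) (cosetSum α σ m) :=
      commute_cosetSum fun i hi => (hσ.comm i (m + 1) (by omega) hm).symm
    have e1 : cosetSum α σ (m + 1) * (σ (m + 1) * W) =
        cosetSum α σ m * (σ m * (σ (m + 1) * W)) + (α ^ (m + 1))⁻¹ • (σ (m + 1) * W) := by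
      rw [cosetSum, add_mul, smul_mul_assoc, one_mul, mul_assoc]
    have e2 : σ (m + 1) * (cosetSum α σ m * (σ m * (σ (m + 1) * W))) =
        α • (cosetSum α σ m * (σ m * (σ (m + 1) * W))) := by
      rw [← mul_assoc, c.eq, mul_assoc]
      have : σ (m + 1) * (σ m * (σ (m + 1) * W)) = α • (σ m * (σ (m + 1) * W)) := by
        rw [← mul_assoc, ← mul_assoc, ← hσ.braid m hm, mul_assoc, hW m (by omega), mul_smul_comm,
          mul_assoc]
      rw [this, mul_smul_comm]
    have e3 : σ (m + 1) * (σ (m + 1) * W) = W + (α - α⁻¹) • (σ (m + 1) * W) := by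
      rw [← mul_assoc, hσ.quad _ hm, add_mul, one_mul, smul_mul_assoc]
    rw [e1, mul_add, e2, mul_smul_comm, e3]
    match_scalars <;> field_simp <;> ring

/-- Summing over coset representatives promotes invariance under the smaller Hecke algebra to the
larger one: the corrections from `sigma_cosetSum_sigma` combine with the last summand of the coset
sum. -/
theorem sigma_mul_cosetSum (h0 : α ≠ 0) (hσ : IsHeckeSeq α N σ) {m : ℕ} (hm : m ≤ N) {W : R}
    (hW : ∀ i, i + 1 < m → σ i * W = α • W) {i : ℕ} (hi : i < m) :
    σ i * (cosetSum α σ m * W) = α • (cosetSum α σ m * W) := by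
  induction m generalizing i W with
  | zero => omega
  | succ m ih =>
    have e : cosetSum α σ (m + 1) * W =
        cosetSum α σ m * (σ m * W) + (α ^ (m + 1))⁻¹ • W := by
      rw [cosetSum, add_mul, smul_mul_assoc, one_mul, mul_assoc]
    have hW' : ∀ i < m, σ i * W = α • W := fun i hi => hW i (by omega)
    rw [e, mul_add, mul_smul_comm]
    rcases Nat.lt_succ_iff_lt_or_eq.1 hi with hi | rfl
    · rw [ih (by omega) (fun k hk => sigma_mul_absorb hσ (by omega) hW' hk) hi, hW' i hi]
      module
    · rw [sigma_cosetSum_sigma h0 hσ (by omega) hW']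
      match_scalars <;> field_simp <;> ring

/-- The bridge between contents and cosets: once the eigenvalue `α⁻²` is subtracted, a Jucys–Murphy
element acts on an invariant of the smaller algebra as a multiple of the coset sum. -/
theorem jmElt_mul (h0 : α ≠ 0) (hσ : IsHeckeSeq α N σ) {m : ℕ} (hm : m ≤ N) {W : R}
    (hW : ∀ i, i + 1 < m → σ i * W = α • W) :
    jmElt σ m * W = (α ^ 2)⁻¹ • W + ((α - α⁻¹) * α ^ m * α⁻¹) • (cosetSum α σ m * W) := by
  induction m generalizing W with
  | zero =>
    simp only [jmElt, cosetSum, one_mul]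
    match_scalars
    field_simp
    ring
  | succ m ih =>
    have hW' : ∀ i < m, σ i * W = α • W := fun i hi => hW i (by omega)
    have e3 : σ m * (σ m * W) = W + (α - α⁻¹) • (σ m * W) := by
      rw [← mul_assoc, hσ.quad _ hm, add_mul, one_mul, smul_mul_assoc]
    have e : cosetSum α σ (m + 1) * W =
        cosetSum α σ m * (σ m * W) + (α ^ (m + 1))⁻¹ • W := by
      rw [cosetSum, add_mul, smul_mul_assoc, one_mul, mul_assoc]
    rw [jmElt, mul_assoc, mul_assoc,
      ih (by omega) (fun k hk => sigma_mul_absorb hσ (by omega) hW' hk), mul_add, mul_smul_comm,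
      mul_smul_comm, e3, sigma_cosetSum_sigma h0 hσ (by omega) hW', e]
    match_scalars <;> field_simp <;> ring

theorem sigma_mul_jmElt_sub (h0 : α ≠ 0) (hσ : IsHeckeSeq α N σ) {m : ℕ} (hm : m ≤ N) {W : R}
    (hW : ∀ i, i + 1 < m → σ i * W = α • W) {i : ℕ} (hi : i < m) :
    σ i * ((jmElt σ m - (α ^ 2)⁻¹ • 1) * W) = α • ((jmElt σ m - (α ^ 2)⁻¹ • 1) * W) := by
  have : (jmElt σ m - (α ^ 2)⁻¹ • 1) * W =
      ((α - α⁻¹) * α ^ m * α⁻¹) • (cosetSum α σ m * W) := by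
    rw [sub_mul, jmElt_mul h0 hσ hm hW, smul_mul_assoc, one_mul]; abel
  rw [this, mul_smul_comm, sigma_mul_cosetSum h0 hσ hm hW hi, smul_comm]

/-- Follows from the left-handed version in the opposite ring, since Jucys–Murphy elements are
palindromes. -/
theorem jmElt_sub_mul_sigma (h0 : α ≠ 0) (hσ : IsHeckeSeq α N σ) {m : ℕ} (hm : m ≤ N) {W : R}
    (hW : ∀ i, i + 1 < m → W * σ i = α • W) {i : ℕ} (hi : i < m) :
    W * (jmElt σ m - (α ^ 2)⁻¹ • 1) * σ i = α • (W * (jmElt σ m - (α ^ 2)⁻¹ • 1)) := by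
  have := sigma_mul_jmElt_sub h0 hσ.op hm (W := MulOpposite.op W)
    (fun i hi => by rw [← MulOpposite.op_mul, hW i hi]; rfl) hi
  rw [jmElt_op] at this
  exact MulOpposite.op_injective this

theorem commute_sigma_jmElt (hσ : IsHeckeSeq α N σ) {m : ℕ} (hm : m ≤ N) {i : ℕ}
    (hi : i + 1 < m) : Commute (σ i) (jmElt σ m) := by
  induction m with
  | zero => omega
  | succ m ih =>
    rcases Nat.lt_succ_iff_lt_or_eq.1 hi with hi | rfl
    · have c := hσ.comm i m hi (by omega)
      exact (c.mul_right (ih (by omega) hi)).mul_right c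
    · have c : Commute (σ (i + 1)) (jmElt σ i) :=
        commute_jmElt fun k hk => (hσ.comm k (i + 1) (by omega) (by omega)).symm
      have b := hσ.braid i (by omega)
      rw [jmElt, jmElt]
      calc σ i * (σ (i + 1) * (σ i * jmElt σ i * σ i) * σ (i + 1))
          = σ i * σ (i + 1) * σ i * jmElt σ i * (σ i * σ (i + 1)) := by simp only [mul_assoc]
        _ = σ (i + 1) * σ i * (σ (i + 1) * jmElt σ i) * (σ i * σ (i + 1)) := by
            rw [b]; simp only [mul_assoc]
        _ = σ (i + 1) * σ i * jmElt σ i * (σ (i + 1) * σ i * σ (i + 1)) := by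
            rw [c.eq]; simp only [mul_assoc]
        _ = _ := by rw [← b]; simp only [mul_assoc]

theorem symmetrizer_mul_sigma (h0 : α ≠ 0) (hσ : IsHeckeSeq α N σ) {m : ℕ} (hm : m ≤ N) {i : ℕ}
    (hi : i < m) : symmetrizer α σ m * σ i = α • symmetrizer α σ m := by
  induction m generalizing i with
  | zero => omega
  | succ m ih =>
    rw [symmetrizer, mul_smul_comm, smul_mul_assoc,
      jmElt_sub_mul_sigma h0 hσ hm (fun k hk => ih (by omega) (by omega)) hi, smul_comm]

/-- The new Jucys–Murphy element commutes with all earlier generators, so its factor can stand on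
the left; this makes left absorption accessible. -/
theorem symmetrizer_succ_eq (hσ : IsHeckeSeq α N σ) {m : ℕ} (hm : m < N) :
    symmetrizer α σ (m + 1) = (α ^ (2 * (m + 1)) - (α ^ 2)⁻¹)⁻¹ •
      ((jmElt σ (m + 1) - (α ^ 2)⁻¹ • 1) * symmetrizer α σ m) := by
  have c : Commute (jmElt σ (m + 1)) (symmetrizer α σ m) :=
    commute_symmetrizer fun i hi => (commute_sigma_jmElt hσ (by omega) (by omega)).symm
  have c' : Commute (jmElt σ (m + 1) - (α ^ 2)⁻¹ • 1) (symmetrizer α σ m) :=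
    c.sub_left ((Commute.one_left _).smul_left _)
  rw [symmetrizer, mul_smul_comm, c'.eq]

theorem sigma_mul_symmetrizer (h0 : α ≠ 0) (hσ : IsHeckeSeq α N σ) {m : ℕ} (hm : m ≤ N) {i : ℕ}
    (hi : i < m) : σ i * symmetrizer α σ m = α • symmetrizer α σ m := by
  induction m generalizing i with
  | zero => omega
  | succ m ih =>
    rw [symmetrizer_succ_eq hσ hm, mul_smul_comm,
      sigma_mul_jmElt_sub h0 hσ hm (fun k hk => ih (by omega) (by omega)) hi, smul_comm]

theorem pow_sub_inv_ne_zero (h0 : α ≠ 0) (hroot : ∀ n : ℕ, 0 < n → α ^ (2 * n) ≠ 1) {n : ℕ}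
    (hn : 0 < n) : α ^ n - (α ^ n)⁻¹ ≠ 0 := by
  intro h
  apply hroot n hn
  have : α ^ n ≠ 0 := pow_ne_zero _ h0
  field_simp at h
  rw [pow_mul']
  linear_combination h

/-- The normalisation is the factorisation of the content difference `α^(2(m+1)) - α⁻²` as `α^m`
times the numerator of `[m + 2]`. -/
theorem symmetrizer_succ (h0 : α ≠ 0) (hroot : ∀ n : ℕ, 0 < n → α ^ (2 * n) ≠ 1)
    (hσ : IsHeckeSeq α N σ) {m : ℕ} (hm : m < N) :
    symmetrizer α σ (m + 1) =
      (qInt α (m + 2))⁻¹ • (cosetSum α σ (m + 1) * symmetrizer α σ m) := by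
  rw [symmetrizer_succ_eq hσ hm, sub_mul, jmElt_mul h0 hσ hm
    (fun k hk => sigma_mul_symmetrizer h0 hσ (by omega) (by omega)), smul_mul_assoc, one_mul,
    add_sub_cancel_left, smul_smul]
  congr 1
  have h1 := pow_sub_inv_ne_zero h0 hroot (n := 1) one_pos
  have h2 := pow_sub_inv_ne_zero h0 hroot (n := m + 2) (by omega)
  rw [pow_one] at h1
  have e : α ^ (2 * (m + 1)) - (α ^ 2)⁻¹ = α ^ m * (α ^ (m + 2) - (α ^ (m + 2))⁻¹) := by
    field_simp
    ring
  rw [e, qInt, inv_div]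
  generalize hl : α - α⁻¹ = l at *
  generalize hk : α ^ (m + 2) - (α ^ (m + 2))⁻¹ = k at *
  field_simp
  exact pow_succ _ _

theorem mul_jmElt_of_absorb {m : ℕ} {Z : R} (hZ : ∀ i < m, Z * σ i = α • Z) :
    Z * jmElt σ m = α ^ (2 * m) • Z := by
  induction m with
  | zero => simp [jmElt]
  | succ m ih =>
    rw [jmElt, ← mul_assoc, ← mul_assoc, hZ m (by omega), smul_mul_assoc,
      ih (fun i hi => hZ i (by omega)), smul_mul_assoc, smul_mul_assoc, hZ m (by omega)]
    module

/-- On `Z` each Jucys–Murphy element acts by its content, so every normalised factor acts as `1`. -/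
theorem mul_symmetrizer_of_absorb (h0 : α ≠ 0) (hroot : ∀ n : ℕ, 0 < n → α ^ (2 * n) ≠ 1) {m : ℕ}
    {Z : R} (hZ : ∀ i < m, Z * σ i = α • Z) : Z * symmetrizer α σ m = Z := by
  induction m with
  | zero => simp [symmetrizer]
  | succ m ih =>
    rw [symmetrizer, ← mul_assoc, ih fun i hi => hZ i (by omega), mul_smul_comm, mul_sub,
      mul_jmElt_of_absorb hZ, mul_smul_comm, mul_one, ← sub_smul, smul_smul,
      inv_mul_cancel₀, one_smul]
    have h2 := pow_sub_inv_ne_zero h0 hroot (n := m + 2) (by omega)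
    have e : α ^ (2 * (m + 1)) - (α ^ 2)⁻¹ = α ^ m * (α ^ (m + 2) - (α ^ (m + 2))⁻¹) := by
      field_simp
      ring
    rw [e]
    exact mul_ne_zero (pow_ne_zero _ h0) h2

theorem cosetSum_mul_of_absorb (h0 : α ≠ 0) (h1 : α - α⁻¹ ≠ 0) {m : ℕ} {W : R}
    (hW : ∀ i < m, σ i * W = α • W) : cosetSum α σ m * W = qInt α (m + 1) • W := by
  induction m with
  | zero => simp [cosetSum, qInt, div_self h1]
  | succ m ih =>
    rw [cosetSum, add_mul, mul_assoc, hW m (by omega), mul_smul_comm,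
      ih fun i hi => hW i (by omega), smul_mul_assoc, one_mul]
    match_scalars
    simp only [qInt]
    have : α ^ 2 - 1 ≠ 0 := by
      intro h; apply h1; field_simp; rw [h, mul_zero]
    field_simp
    ring

theorem mul_cosetSum_of_absorb (h0 : α ≠ 0) (h1 : α - α⁻¹ ≠ 0) {m : ℕ} {W : R}
    (hW : ∀ i < m, W * σ i = α • W) : W * cosetSum α σ m = qInt α (m + 1) • W := by
  induction m with
  | zero => simp [cosetSum, qInt, div_self h1]
  | succ m ih =>
    rw [cosetSum, mul_add, ← mul_assoc, ih fun i hi => hW i (by omega), smul_mul_assoc,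
      hW m (by omega), mul_smul_comm, mul_one]
    match_scalars
    simp only [qInt]
    have : α ^ 2 - 1 ≠ 0 := by
      intro h; apply h1; field_simp; rw [h, mul_zero]
    field_simp
    ring

end

end Abstract

/-! ### Rows of generators and their inverses -/

section Abstract

variable {R : Type*} [Ring R] [Algebra ℂ R]

/-- `σ_0 σ_1 ⋯ σ_{m-1}`. -/
def sigmaRow (σ : ℕ → R) : ℕ → R
  | 0 => 1
  | m + 1 => sigmaRow σ m * σ m

/-- `σ_{m-1}⁻¹ ⋯ σ_0⁻¹`, where `σ_i⁻¹ = σ_i - (α - α⁻¹)`. -/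
noncomputable def sigmaRowInv (α : ℂ) (σ : ℕ → R) : ℕ → R
  | 0 => 1
  | m + 1 => (σ m - (α - α⁻¹) • 1) * sigmaRowInv α σ m

/-- The value of `baxRow α σ m z` on an absorbing element. -/
noncomputable def rowEval (α : ℂ) : ℕ → ℂ → ℂ
  | 0, _ => 1
  | m + 1, z => (α + (α - α⁻¹) * z / (1 - z)) * rowEval α m (z * α ^ 2)

/-- Each factor equals `α (1 - z/α²) / (1 - z)`, so the product along `z, zα², …` telescopes. -/
theorem rowEval_mul {α : ℂ} (h0 : α ≠ 0) {m : ℕ} {z : ℂ} (hz : ∀ k < m, z * α ^ (2 * k) ≠ 1) :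
    rowEval α m z * (1 - z * α ^ (2 * m) / α ^ 2) = α ^ m * (1 - z / α ^ 2) := by
  induction m generalizing z with
  | zero => simp [rowEval]
  | succ m ih =>
    have hz1 : 1 - z ≠ 0 := sub_ne_zero.2 (by simpa using (hz 0 (by omega)).symm)
    have := ih (z := z * α ^ 2) fun k hk => by
      have := hz (k + 1) (by omega)
      rwa [mul_add, pow_add, mul_comm (α ^ (2 * k)), ← mul_assoc] at this
    have e : z * α ^ (2 * (m + 1)) / α ^ 2 = z * α ^ 2 * α ^ (2 * m) / α ^ 2 := by ring
    rw [rowEval, e, mul_assoc, this]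
    field_simp
    ring

theorem mul_sigma_inv_of_absorb {α : ℂ} {s W : R} (hW : W * s = α • W) :
    W * (s - (α - α⁻¹) • 1) = α⁻¹ • W := by
  rw [mul_sub, hW, mul_smul_comm, mul_one]; module

theorem mul_baxRow_of_absorb {α : ℂ} {σ : ℕ → R} {m : ℕ} {W : R}
    (hW : ∀ i < m, W * σ i = α • W) (z : ℂ) : W * baxRow α σ m z = rowEval α m z • W := by
  induction m generalizing z with
  | zero => simp [baxRow, rowEval]
  | succ m ih =>
    rw [baxRow, rowEval, bax_eq_smul, ← mul_assoc, mul_add, hW m (by omega), mul_smul_comm, mul_one,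
      ← add_smul, smul_mul_assoc, ih (fun i hi => hW i (by omega)), smul_smul]

theorem mul_sigmaRowInv_of_absorb {α : ℂ} {σ : ℕ → R} {m : ℕ} {W : R}
    (hW : ∀ i < m, W * σ i = α • W) : W * sigmaRowInv α σ m = (α ^ m)⁻¹ • W := by
  induction m with
  | zero => simp [sigmaRowInv]
  | succ m ih =>
    rw [sigmaRowInv, ← mul_assoc, mul_sigma_inv_of_absorb (hW m (by omega)), smul_mul_assoc,
      ih (fun i hi => hW i (by omega)), smul_smul, pow_succ', mul_inv]

theorem commute_sigmaRowInv {α : ℂ} {σ : ℕ → R} {m : ℕ} {r : R} (h : ∀ i < m, Commute r (σ i)) :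
    Commute r (sigmaRowInv α σ m) := by
  induction m with
  | zero => exact Commute.one_right _
  | succ m ih =>
    exact ((h m (by omega)).sub_right ((Commute.one_right _).smul_right _)).mul_right
      (ih fun i hi => h i (by omega))

/-- Write each factor as `σ_i⁻¹` plus a scalar. At the first scalar chosen, `W` evaluates the rest
of the row, and `φ` strips the inverses already chosen. Only the full inverse row contains `σ_0⁻¹`,
which `φ` need not strip. -/
theorem map_baxRow_sub {α : ℂ} (h0 : α ≠ 0) {N : ℕ} {σ : ℕ → R} (hσ : IsHeckeSeq α N σ)
    {V : Type*} [AddCommGroup V] [Module ℂ V] (φ : R →ₗ[ℂ] V)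
    (hφ : ∀ Z i, 1 ≤ i → i < N → φ (Z * (σ i - (α - α⁻¹) • 1)) = α⁻¹ • φ Z) {m : ℕ} (hm : m ≤ N)
    {W : R} (hW : ∀ i, i + 1 < m → W * σ i = α • W) {z : ℂ} (hz : ∀ k < m, z * α ^ (2 * k) ≠ 1) :
    φ (W * baxRow α σ m z) =
      φ (W * sigmaRowInv α σ m) + (rowEval α m z - (α ^ m)⁻¹) • φ W := by
  induction m generalizing W z with
  | zero => simp [baxRow, rowEval, sigmaRowInv]
  | succ m ih =>
    have hz1 : 1 - z ≠ 0 := sub_ne_zero.2 (by simpa using (hz 0 (by omega)).symm)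
    have e : bax α (σ m) z = (σ m - (α - α⁻¹) • 1) + ((α - α⁻¹) / (1 - z)) • (1 : R) := by
      rw [bax_eq_smul]
      match_scalars <;> field_simp
      ring
    have hz' : ∀ k < m, z * α ^ 2 * α ^ (2 * k) ≠ 1 := fun k hk => by
      have := hz (k + 1) (by omega)
      rwa [mul_add, pow_add, mul_comm (α ^ (2 * k)), ← mul_assoc] at this
    have hW' : ∀ i, i + 1 < m →
        W * (σ m - (α - α⁻¹) • 1) * σ i = α • (W * (σ m - (α - α⁻¹) • 1)) := fun i hi =>
      absorb_commute ((hσ.comm i m hi (by omega)).symm.sub_left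
        ((Commute.one_left _).smul_left _)) (hW i (by omega))
    rw [baxRow, sigmaRowInv, e, add_mul, mul_add, map_add, ← mul_assoc,
      ih (by omega) hW' hz', smul_mul_assoc, one_mul, mul_smul_comm,
      mul_baxRow_of_absorb (fun i hi => hW i (by omega)), ← mul_assoc, map_smul, map_smul]
    -- For `m = 0` the term containing `σ_0⁻¹` has coefficient `rowEval α 0 _ - 1 = 0`, so `hφ` is
    -- needed only for positive indices.
    rcases Nat.eq_zero_or_pos m with rfl | h
    · simp only [rowEval, pow_zero, inv_one, sub_self, zero_smul, zero_add, mul_one, pow_one,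
        add_zero, one_smul]
      congr 2
      field_simp
      ring
    · rw [hφ W m h (by omega), rowEval]
      match_scalars <;> field_simp
      ring

/-- Isolates the longest representative, the only summand containing `σ 0`. -/
theorem cosetSum_succ_eq (α : ℂ) (σ : ℕ → R) (m : ℕ) :
    cosetSum α σ (m + 1) =
      sigmaRow σ (m + 1) + α⁻¹ • cosetSum α (fun i => σ (i + 1)) m := by
  induction m with
  | zero => simp [cosetSum, sigmaRow]
  | succ m ih =>
    rw [cosetSum, ih, cosetSum, add_mul, smul_mul_assoc, smul_add, smul_smul, add_assoc, ← mul_inv,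
      ← pow_succ']
    rfl

theorem sigmaRowInv_mul_sigma {α : ℂ} {N : ℕ} {σ : ℕ → R} (hσ : IsHeckeSeq α N σ) {m : ℕ}
    (hm : m ≤ N) {i : ℕ} (hi : i + 1 < m) :
    sigmaRowInv α σ m * σ (i + 1) = σ i * sigmaRowInv α σ m := by
  induction m with
  | zero => omega
  | succ m ih =>
    rcases Nat.lt_succ_iff_lt_or_eq.1 hi with hi | rfl
    · have c : Commute (σ m - (α - α⁻¹) • 1) (σ i) :=
        (hσ.comm i m hi (by omega)).symm.sub_left ((Commute.one_left _).smul_left _)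
      rw [sigmaRowInv, mul_assoc, ih (by omega) hi, ← mul_assoc, c.eq, mul_assoc]
    · have c : Commute (σ (i + 1)) (sigmaRowInv α σ i) :=
        commute_sigmaRowInv fun k hk => (hσ.comm k (i + 1) (by omega) (by omega)).symm
      have b := hσ.braid i (by omega)
      have q1 := hσ.quad i (by omega)
      have q2 := hσ.quad (i + 1) (by omega)
      have key : (σ (i + 1) - (α - α⁻¹) • 1) * (σ i - (α - α⁻¹) • 1) * σ (i + 1) =
          σ i * ((σ (i + 1) - (α - α⁻¹) • 1) * (σ i - (α - α⁻¹) • 1)) := by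
        simp only [mul_sub, sub_mul, mul_smul_comm, smul_mul_assoc, mul_one, one_mul, ← mul_assoc]
        rw [b, q1, q2]
        module
      rw [sigmaRowInv, sigmaRowInv, mul_assoc, mul_assoc _ _ (σ (i + 1)), ← c.eq, ← mul_assoc,
        ← mul_assoc, key]
      simp only [mul_assoc]

/-- The inverse row intertwines `σ (i + 1)` with `σ i`, so it lowers a shifted coset sum to one that
`W` can absorb. -/
theorem sigmaRowInv_mul_cosetSum {α : ℂ} {N : ℕ} {σ : ℕ → R} (hσ : IsHeckeSeq α N σ) {m : ℕ}
    (hm : m ≤ N) {k : ℕ} (hk : k < m) :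
    sigmaRowInv α σ m * cosetSum α (fun i => σ (i + 1)) k =
      cosetSum α σ k * sigmaRowInv α σ m := by
  induction k with
  | zero => simp [cosetSum]
  | succ k ih =>
    rw [cosetSum, cosetSum, mul_add, add_mul, ← mul_assoc, ih (by omega), mul_assoc,
      sigmaRowInv_mul_sigma hσ hm hk, mul_assoc, mul_smul_comm, smul_mul_assoc, mul_one, one_mul]

section Map

variable {R' : Type*} [Ring R'] [Algebra ℂ R'] (f : R →ₐ[ℂ] R') {σ : ℕ → R} {σ' : ℕ → R'} {α : ℂ}

theorem map_bax (s : R) (x : ℂ) : f (bax α s x) = bax α (f s) x := by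
  simp [bax]

theorem map_baxRow {m : ℕ} (h : ∀ i < m, f (σ i) = σ' i) (z : ℂ) :
    f (baxRow α σ m z) = baxRow α σ' m z := by
  induction m generalizing z with
  | zero => simp [baxRow]
  | succ m ih => simp only [baxRow, map_mul, map_bax, h m (by omega), ih fun i hi => h i (by omega)]

theorem map_fusedProd {m : ℕ} (h : ∀ i, i + 1 < m → f (σ i) = σ' i) {τ : ℂ → R} {τ' : ℂ → R'}
    {x : ℂ} (hτ : ∀ i < m, f (τ (x * α ^ (2 * i))) = τ' (x * α ^ (2 * i))) :
    f (fusedProd α σ τ x m) = fusedProd α σ' τ' x m := by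
  induction m with
  | zero => simp [fusedProd]
  | succ m ih =>
    rw [fusedProd, fusedProd, map_mul, map_mul, ih (fun i hi => h i (by omega)) fun i hi =>
      hτ i (by omega), map_baxRow f fun i hi => h i (by omega), hτ m (by omega)]

theorem map_jmElt {m : ℕ} (h : ∀ i < m, f (σ i) = σ' i) : f (jmElt σ m) = jmElt σ' m := by
  induction m with
  | zero => simp [jmElt]
  | succ m ih => simp only [jmElt, map_mul, h m (by omega), ih fun i hi => h i (by omega)]

theorem map_symmetrizer {m : ℕ} (h : ∀ i < m, f (σ i) = σ' i) :
    f (symmetrizer α σ m) = symmetrizer α σ' m := by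
  induction m with
  | zero => simp [symmetrizer]
  | succ m ih =>
    rw [symmetrizer, symmetrizer, map_mul, ih fun i hi => h i (by omega), map_smul, map_sub,
      map_jmElt f h, map_smul, map_one]

theorem map_cosetSum {m : ℕ} (h : ∀ i < m, f (σ i) = σ' i) :
    f (cosetSum α σ m) = cosetSum α σ' m := by
  induction m with
  | zero => simp [cosetSum]
  | succ m ih =>
    rw [cosetSum, cosetSum, map_add, map_mul, ih fun i hi => h i (by omega), h m (by omega),
      map_smul, map_one]

theorem map_sigmaRow {m : ℕ} (h : ∀ i < m, f (σ i) = σ' i) :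
    f (sigmaRow σ m) = sigmaRow σ' m := by
  induction m with
  | zero => simp [sigmaRow]
  | succ m ih => rw [sigmaRow, sigmaRow, map_mul, ih fun i hi => h i (by omega), h m (by omega)]

theorem map_sigmaRowInv {m : ℕ} (h : ∀ i < m, f (σ i) = σ' i) :
    f (sigmaRowInv α σ m) = sigmaRowInv α σ' m := by
  induction m with
  | zero => simp [sigmaRowInv]
  | succ m ih =>
    rw [sigmaRowInv, sigmaRowInv, map_mul, ih fun i hi => h i (by omega), map_sub, h m (by omega),
      map_smul, map_one]

end Map

end Abstract

/-! ### The affine Hecke algebra as an instance of the abstract setting -/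

section Concrete

variable {q : ℂ} {S : Set ℂ}

theorem mk_rel {n : ℕ} {u v : FreeAlgebra ℂ (Gen S n)} (h : Rel q S n u v) :
    RingQuot.mkAlgHom ℂ (Rel q S n) u = RingQuot.mkAlgHom ℂ (Rel q S n) v :=
  RingQuot.mkAlgHom_rel ℂ h

theorem sigma_sq (hq : q ≠ 0) {n i : ℕ} (h : 1 ≤ i ∧ i < n) :
    sigma q S n i * sigma q S n i = 1 + (q - q⁻¹) • sigma q S n i := by
  have := mk_rel (q := q) (S := S) (Rel.quad i h)
  simp only [map_mul, map_sub, map_add, map_zero, AlgHom.commutes] at this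
  simp only [Algebra.algebraMap_eq_smul_one] at this
  rw [sigma, dif_pos h]
  simp only [sub_mul, mul_add, smul_mul_assoc, mul_smul_comm, one_mul, mul_one, smul_sub,
    smul_smul, one_smul, inv_mul_cancel₀ hq] at this
  rw [← sub_eq_zero, ← this]
  match_scalars <;> ring

theorem sigma_braid {n i : ℕ} (h : 1 ≤ i ∧ i + 1 < n) :
    sigma q S n i * sigma q S n (i + 1) * sigma q S n i =
      sigma q S n (i + 1) * sigma q S n i * sigma q S n (i + 1) := by
  have := mk_rel (q := q) (S := S) (Rel.braid i ⟨h.1, by omega⟩ ⟨by omega, h.2⟩)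
  rw [sigma, sigma, dif_pos ⟨h.1, by omega⟩, dif_pos ⟨by omega, h.2⟩]
  simpa only [map_mul] using this

theorem sigma_comm {n i k : ℕ} (hi : 1 ≤ i) (hik : i + 1 < k) (hk : k < n) :
    Commute (sigma q S n i) (sigma q S n k) := by
  have := mk_rel (q := q) (S := S) (Rel.far i k ⟨hi, by omega⟩ ⟨by omega, hk⟩ hik)
  rw [sigma, sigma, dif_pos ⟨hi, by omega⟩, dif_pos ⟨by omega, hk⟩]
  rwa [map_mul, map_mul] at this

theorem tau_one_comm_sigma {n i : ℕ} (hi : 2 ≤ i) (hn : i < n) :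
    Commute (tau q S n 1) (sigma q S n i) := by
  have := mk_rel (q := q) (S := S) (Rel.tauSigma 1 i ⟨le_rfl, by omega⟩ ⟨by omega, hn⟩ (by omega)
    (by omega))
  rw [sigma, tau, dif_pos ⟨le_rfl, by omega⟩, dif_pos ⟨by omega, hn⟩]
  rwa [map_mul, map_mul] at this

theorem sigma_tau_sigma_tau {n : ℕ} (hn : 1 < n) :
    sigma q S n 1 * tau q S n 1 * sigma q S n 1 * tau q S n 1 =
      tau q S n 1 * sigma q S n 1 * tau q S n 1 * sigma q S n 1 := by
  have h1 := mk_rel (q := q) (S := S) (Rel.tauSucc 1 ⟨le_rfl, hn⟩ ⟨le_rfl, by omega⟩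
    ⟨by omega, by omega⟩)
  have h2 := mk_rel (q := q) (S := S) (Rel.tauTau 1 2 ⟨le_rfl, hn.le⟩ ⟨one_le_two, hn⟩)
  simp only [map_mul] at h1 h2
  rw [sigma, tau, dif_pos ⟨le_rfl, hn⟩, dif_pos ⟨le_rfl, by omega⟩]
  erw [h1] at h2
  rw [h2]
  simp only [mul_assoc]

theorem exists_tau_inv {n : ℕ} (hn : 1 ≤ n) {a : ℂ} (ha : a = 0 ∨ a ∈ S) :
    ∃ P : Alg q S n, (tau q S n 1 - a • 1) * P = 1 ∧ P * (tau q S n 1 - a • 1) = 1 := by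
  have h1 := mk_rel (q := q) (S := S) (Rel.resRight a ⟨hn, ha⟩ ⟨le_rfl, hn⟩)
  have h2 := mk_rel (q := q) (S := S) (Rel.resLeft a ⟨hn, ha⟩ ⟨le_rfl, hn⟩)
  simp only [map_mul, map_sub, map_one, AlgHom.commutes] at h1 h2
  simp only [Algebra.algebraMap_eq_smul_one] at h1 h2
  rw [tau, dif_pos ⟨le_rfl, hn⟩]
  exact ⟨_, h1, h2⟩

theorem isUnit_tau_sub {n : ℕ} (hn : 1 ≤ n) {a : ℂ} (ha : a = 0 ∨ a ∈ S) :
    IsUnit (tau q S n 1 - a • (1 : Alg q S n)) := by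
  obtain ⟨P, h1, h2⟩ := exists_tau_inv (q := q) hn ha
  exact ⟨⟨_, P, h1, h2⟩, rfl⟩

theorem incl_sigma {n i : ℕ} (h : 1 ≤ i ∧ i < n) :
    incl q S n (sigma q S n i) = sigma q S (n + 1) i := by
  rw [sigma, sigma, dif_pos h, dif_pos ⟨h.1, by omega⟩, incl, RingQuot.liftAlgHom_mkAlgHom_apply,
    FreeAlgebra.lift_ι_apply, inclGen]

theorem incl_tau {n i : ℕ} (h : 1 ≤ i ∧ i ≤ n) :
    incl q S n (tau q S n i) = tau q S (n + 1) i := by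
  rw [tau, tau, dif_pos h, dif_pos ⟨h.1, by omega⟩, incl, RingQuot.liftAlgHom_mkAlgHom_apply,
    FreeAlgebra.lift_ι_apply, inclGen]

theorem inverse_sigma (hq : q ≠ 0) {n i : ℕ} (h : 1 ≤ i ∧ i < n) :
    Ring.inverse (sigma q S n i) = sigma q S n i - (q - q⁻¹) • 1 := by
  have h1 : sigma q S n i * (sigma q S n i - (q - q⁻¹) • 1) = 1 := by
    rw [mul_sub, sigma_sq hq h, mul_smul_comm, mul_one]; abel
  have h2 : (sigma q S n i - (q - q⁻¹) • 1) * sigma q S n i = 1 := by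
    rw [sub_mul, sigma_sq hq h, smul_mul_assoc, one_mul]; abel
  exact Ring.inverse_unit ⟨_, _, h1, h2⟩

theorem commute_ringInverse {M : Type*} [MonoidWithZero M] {a b : M} (h : Commute a b) :
    Commute a (Ring.inverse b) := by
  by_cases hb : IsUnit b
  · obtain ⟨u, rfl⟩ := hb
    rw [Ring.inverse_unit]
    exact h.units_inv_right
  · rw [Ring.inverse_non_unit _ hb]
    exact Commute.zero_right _

theorem baxX_eq {α : ℂ} (hα : α - α⁻¹ = q - q⁻¹) (n i : ℕ) (x : ℂ) :
    baxX q S n i x = bax α (sigma q S n i) x := by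
  rw [baxX, bax, hα]

theorem commute_sigma_baxTau (ξ : ℂ) {n j i : ℕ} (hji : j < i) (hi : i < n) (x : ℂ) :
    Commute (sigma q S n i) (baxTau q S ξ n j x) := by
  induction j with
  | zero => exact Commute.one_right _
  | succ j ih =>
    cases j with
    | zero =>
      have c : ∀ a : ℂ, Commute (sigma q S n i) (tau q S n 1 - algebraMap ℂ _ a) := fun a =>
        (tau_one_comm_sigma (by omega) hi).symm.sub_right (Algebra.commutes _ _).symm
      exact (c _).mul_right (commute_ringInverse (c _))
    | succ j =>
      have c : Commute (sigma q S n i) (baxX q S n (j + 1) x) :=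
        (sigma_comm (by omega) (by omega) hi).symm.add_right (Algebra.commutes _ _).symm
      exact (c.mul_right (ih (by omega))).mul_right c

/-- `hx` makes the denominator a unit already in the smaller algebra; `Ring.inverse` is compatible
with a homomorphism at units, but not in general elsewhere. -/
theorem incl_baxTau {ξ : ℂ} {n j : ℕ} (hj : 1 ≤ j) (hn : j ≤ n) {x : ℂ}
    (hx : ξ * x⁻¹ ∈ insert 0 S) :
    incl q S n (baxTau q S ξ n j x) = baxTau q S ξ (n + 1) j x := by
  induction j with
  | zero => omega
  | succ j ih =>
    cases j with
    | zero =>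
      have u := isUnit_tau_sub (q := q) (S := S) hn hx
      rw [← Algebra.algebraMap_eq_smul_one] at u
      have e : ∀ a : ℂ, incl q S n (tau q S n 1 - algebraMap ℂ _ a) =
          tau q S (n + 1) 1 - algebraMap ℂ _ a := fun a => by
        rw [map_sub, incl_tau ⟨le_rfl, hn⟩, AlgHom.commutes]
      rw [baxTau, baxTau, map_mul, e, ← e (ξ * x⁻¹)]
      congr 1
      obtain ⟨v, hv⟩ := u
      rw [← hv, Ring.inverse_unit]
      have : incl q S n v = (Units.map (incl q S n : Alg q S n →* Alg q S (n + 1)) v : _) := rfl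
      rw [this, Ring.inverse_unit]
      rfl
    | succ j =>
      have e : incl q S n (baxX q S n (j + 1) x) = baxX q S (n + 1) (j + 1) x := by
        rw [baxX, baxX, map_add, incl_sigma ⟨by omega, by omega⟩, AlgHom.commutes]
      rw [baxTau, baxTau, map_mul, map_mul, e, ih (by omega) (by omega)]

/-- The reflection equation for the Baxterized boundary elements. -/
theorem reflection {ξ α : ℂ} (hq : q ≠ 0) (hα : α - α⁻¹ = q - q⁻¹) {n k : ℕ} (hn : k + 1 < n)
    {u v : ℂ} (hu0 : u ≠ 0) (hv0 : v ≠ 0) (hu : 1 ≤ k → u ≠ 1) (hv : 1 ≤ k → v ≠ 1) (huv : u ≠ v)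
    (huv1 : u * v ≠ 1) (hξu : ξ * u⁻¹ ∈ insert 0 S) (hξv : ξ * v⁻¹ ∈ insert 0 S) :
    bax α (sigma q S n (k + 1)) (u / v) * baxTau q S ξ n (k + 1) u *
        bax α (sigma q S n (k + 1)) (u * v) * baxTau q S ξ n (k + 1) v =
      baxTau q S ξ n (k + 1) v * bax α (sigma q S n (k + 1)) (u * v) *
        baxTau q S ξ n (k + 1) u * bax α (sigma q S n (k + 1)) (u / v) := by
  have hsq : ∀ i, 1 ≤ i → i < n → sigma q S n i * sigma q S n i =
      1 + (α - α⁻¹) • sigma q S n i := fun i h1 h2 => by rw [hα]; exact sigma_sq hq ⟨h1, h2⟩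
  induction k with
  | zero =>
    have inv : ∀ a : ℂ, a ∈ insert 0 S → (tau q S n 1 - a • 1) *
        Ring.inverse (tau q S n 1 - a • (1 : Alg q S n)) = 1 ∧
        Ring.inverse (tau q S n 1 - a • (1 : Alg q S n)) * (tau q S n 1 - a • 1) = 1 := fun a ha =>
      ⟨Ring.mul_inverse_cancel _ (isUnit_tau_sub (by omega) ha),
        Ring.inverse_mul_cancel _ (isUnit_tau_sub (by omega) ha)⟩
    simp only [zero_add, baxTau, Algebra.algebraMap_eq_smul_one]
    exact reflection_base hu0 hv0 huv huv1 (hsq 1 le_rfl hn) (sigma_tau_sigma_tau hn)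
      (inv _ hξu).1 (inv _ hξu).2 (inv _ hξv).1 (inv _ hξv).2
  | succ k ih =>
    have := ih (by omega) (fun _ => hu (by omega)) (fun _ => hv (by omega))
    simp only [baxTau, baxX_eq hα]
    exact reflection_step (hu (by omega)) (hv (by omega)) hv0 huv huv1 (hsq _ (by omega) (by omega))
      (hsq _ (by omega) hn) (sigma_braid ⟨by omega, hn⟩)
      (commute_sigma_baxTau ξ (by omega) hn u) (commute_sigma_baxTau ξ (by omega) hn v) this

/-- The generators `σ_{k+1}, σ_{k+2}, …` of `Ĥ_n`. -/
def sigmaSeq (q : ℂ) (S : Set ℂ) (n k i : ℕ) : Alg q S n := sigma q S n (k + i + 1)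

theorem isHeckeSeq_sigmaSeq {α : ℂ} (hq : q ≠ 0) (hα : α - α⁻¹ = q - q⁻¹) {n k N : ℕ}
    (hN : k + N < n) : IsHeckeSeq α N (sigmaSeq q S n k) :=
  ⟨fun i hi => by rw [hα]; exact sigma_sq hq ⟨by omega, by omega⟩,
    fun i hi => sigma_braid ⟨by omega, by omega⟩,
    fun i l hi hl => sigma_comm (by omega) (by omega) (by omega)⟩

theorem incl_sigmaSeq {n k i : ℕ} (h : k + i + 1 < n) :
    incl q S n (sigmaSeq q S n k i) = sigmaSeq q S (n + 1) k i :=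
  incl_sigma ⟨by omega, h⟩

theorem jucysMurphy_eq (n k i : ℕ) :
    jucysMurphy q S n (k + 1) (i + 1) = jmElt (sigmaSeq q S n k) i := by
  induction i with
  | zero => rfl
  | succ i ih =>
    rw [jucysMurphy, jmElt, ih, sigmaSeq, Nat.add_right_comm k 1 i]

theorem sub_ne_zero_of_ne_zero (hq : q ≠ 0) (s : ℤˣ) : sub s q ≠ 0 := by
  rcases Int.units_eq_one_or s with rfl | rfl <;> simp [sub, hq]

theorem sub_sub_inv (s : ℤˣ) : sub s q - (sub s q)⁻¹ = q - q⁻¹ := by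
  rcases Int.units_eq_one_or s with rfl | rfl <;> simp [sub]
  ring

theorem sub_sq (s : ℤˣ) : sub s q ^ 2 = q ^ (2 * (s : ℤ)) := by
  rcases Int.units_eq_one_or s with rfl | rfl
  · simp [sub]
  · simp [sub]

theorem sub_pow_two_mul (s : ℤˣ) (n : ℕ) : sub s q ^ (2 * n) = q ^ (2 * (s : ℤ) * n) := by
  rw [pow_mul, sub_sq, ← zpow_natCast, ← zpow_mul]

theorem content_eq (s : ℤˣ) (k : ℕ) : content q s (k + 1) = sub s q ^ (2 * k) := by
  rw [sub_pow_two_mul, content]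
  congr 1
  push_cast
  ring

theorem sub_pow_ne_one (hroot : ∀ n : ℕ, 0 < n → q ^ n ≠ 1) (s : ℤˣ) {n : ℕ} (hn : 0 < n) :
    sub s q ^ n ≠ 1 := by
  intro h
  apply hroot (2 * n) (by omega)
  have h2 : sub s q ^ (2 * n) = 1 := by rw [mul_comm, pow_mul, h, one_pow]
  rcases Int.units_eq_one_or s with rfl | rfl
  · simpa [sub] using h2
  · simpa [sub, pow_mul] using h2

/-- Quantum integers are invariant under inversion of the parameter, so `±q` and `±q^{±1}` give the
same value. -/
theorem qInt_sub (s : ℤˣ) (m : ℕ) :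
    qInt (((s : ℤ) : ℂ) * q) m = qInt (sub s q) m := by
  rcases Int.units_eq_one_or s with rfl | rfl
  · simp [sub]
  · have e : sub (-1) q = (-q)⁻¹ := by simp [sub, inv_neg]
    have e' : (((-1 : ℤˣ) : ℤ) : ℂ) * q = -q := by simp
    rw [e, e', qInt, qInt, inv_pow, inv_inv, inv_inv, ← neg_sub, ← neg_sub (-q)⁻¹, neg_div_neg_eq]

theorem idem_eq (s : ℤˣ) (n k m : ℕ) :
    idem q S s n (k + 1) (m + 1) = symmetrizer (sub s q) (sigmaSeq q S n k) m := by
  induction m with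
  | zero => rfl
  | succ m ih =>
    have : q ^ (-2 * (s : ℤ)) = (sub s q ^ 2)⁻¹ := by
      rw [sub_sq, ← zpow_neg, neg_mul]
    rw [idem, symmetrizer, ih, this, content_eq, jucysMurphy_eq, Algebra.algebraMap_eq_smul_one]

theorem baxXBack_eq {α : ℂ} (hα : α - α⁻¹ = q - q⁻¹) (n k m : ℕ) (z : ℂ) (u : ℕ → ℂ)
    (hu : ∀ i, u (i + 1) = α ^ (2 * i)) :
    baxXBack q S n m (k + 1) z u = baxRow α (sigmaSeq q S n k) m z := by
  have gen : ∀ (m : ℕ) (z : ℂ), ((List.range m).map fun i =>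
      baxX q S n (k + m - i) (z * α ^ (2 * i))).prod = baxRow α (sigmaSeq q S n k) m z := by
    intro m
    induction m with
    | zero => intro z; rfl
    | succ m ih =>
      intro z
      rw [List.range_succ_eq_map, List.map_cons, List.prod_cons, List.map_map, baxRow, ← ih]
      congr 1
      · rw [baxX_eq hα, sigmaSeq]; simp; rfl
      · congr 2
        funext i
        simp only [Function.comp]
        congr 1
        · omega
        · rw [Nat.succ_eq_add_one]; ring
  rw [← gen, baxXBack]
  congr 2
  funext i
  rw [hu]
  congr 1
  omega

theorem fusedB_eq {α : ℂ} (hα : α - α⁻¹ = q - q⁻¹) (ξ : ℂ) (n k m : ℕ) (x : ℂ) (u : ℕ → ℂ)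
    (hu : ∀ i, u (i + 1) = α ^ (2 * i)) :
    fusedB q S ξ n m (k + 1) u x =
      fusedProd α (sigmaSeq q S n k) (baxTau q S ξ n (k + 1)) x m := by
  induction m with
  | zero => rfl
  | succ m ih =>
    rw [fusedProd, ← ih, fusedB, fusedB, List.range_succ, List.map_append, List.prod_append]
    simp only [List.map_cons, List.map_nil, List.prod_cons, List.prod_nil, mul_one]
    rw [baxXBack_eq hα _ _ _ _ _ hu, hu]

end Concrete

/-! ### Cyclicity, conjugation and the scalar `η` -/

section Trace

variable {q : ℂ} {S : Set ℂ}

/-- The composite homomorphism `Ĥ_k → Ĥ_{k+m}`. -/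
def inclIter (q : ℂ) (S : Set ℂ) (k : ℕ) : (m : ℕ) → Alg q S k →ₐ[ℂ] Alg q S (k + m)
  | 0 => AlgHom.id ℂ _
  | m + 1 => (incl q S (k + m)).comp (inclIter q S k m)

namespace MarkovTrace

variable (T : MarkovTrace q S)

theorem tr_incl_mul (n : ℕ) (X : Alg q S n) (Y : Alg q S (n + 1)) :
    T.tr n (incl q S n X * Y) = X * T.tr n Y := by
  simpa using T.tr_bimodule n X 1 Y

theorem tr_mul_incl (n : ℕ) (X : Alg q S n) (Y : Alg q S (n + 1)) :
    T.tr n (Y * incl q S n X) = T.tr n Y * X := by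
  simpa using T.tr_bimodule n 1 X Y

theorem iter_mul_inclIter (k m : ℕ) (X : Alg q S k) (Y : Alg q S (k + m)) :
    T.iter k m (Y * inclIter q S k m X) = T.iter k m Y * X := by
  induction m with
  | zero => rfl
  | succ m ih =>
    change T.iter k m (T.tr (k + m) (Y * incl q S (k + m) (inclIter q S k m X))) = _
    rw [tr_mul_incl, ih]
    rfl

theorem iter_sigma_mul (k m i : ℕ) (hi : i + 1 < m) (Y : Alg q S (k + m)) :
    T.iter k m (sigmaSeq q S (k + m) k i * Y) = T.iter k m (Y * sigmaSeq q S (k + m) k i) := by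
  induction m with
  | zero => omega
  | succ m ih =>
    rcases Nat.lt_succ_iff_lt_or_eq.1 hi with hi | rfl
    · change T.iter k m (T.tr (k + m) (sigmaSeq q S (k + m + 1) k i * Y)) =
        T.iter k m (T.tr (k + m) (Y * sigmaSeq q S (k + m + 1) k i))
      rw [← incl_sigmaSeq (by omega), tr_incl_mul, tr_mul_incl, ih hi]
    · exact congrArg (T.iter k i) (T.tr_cyclic (k + i) Y)

/-- Each outer conjugation by a generator lowers the strand of the partial trace by one, until the
trace is over strand `k + 1`. -/
theorem tr_conj_row (hq : q ≠ 0) {α : ℂ} (hα : α - α⁻¹ = q - q⁻¹) {k m : ℕ}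
    (y : (n : ℕ) → Alg q S n) (hy : ∀ n, k < n → incl q S n (y n) = y (n + 1)) :
    T.tr (k + m) (sigmaRowInv α (sigmaSeq q S (k + m + 1) k) m * y (k + m + 1) *
      sigmaRow (sigmaSeq q S (k + m + 1) k) m) = inclIter q S k m (T.tr k (y (k + 1))) := by
  induction m with
  | zero => simp [sigmaRowInv, sigmaRow, inclIter]
  | succ m ih =>
    have h1 := T.tr_conj_inv (k + m) (sigmaRowInv α (sigmaSeq q S (k + m + 1) k) m *
      y (k + m + 1) * sigmaRow (sigmaSeq q S (k + m + 1) k) m)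
    rw [ih] at h1
    rw [map_mul (incl q S _), map_mul (incl q S _), hy _ (by omega), map_sigmaRowInv (incl q S (k + m + 1))
      (σ' := sigmaSeq q S (k + m + 2) k) (fun i hi => incl_sigmaSeq (by omega)),
      map_sigmaRow (incl q S (k + m + 1))
      (σ' := sigmaSeq q S (k + m + 2) k) (fun i hi => incl_sigmaSeq (by omega)),
      inverse_sigma hq ⟨by omega, by omega⟩, ← hα] at h1
    refine Eq.trans ?_ h1
    change T.tr (k + m + 1) _ = _
    congr 1
    rw [sigmaRowInv, sigmaRow]
    simp only [mul_assoc]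
    rfl

/-- Comes from `σ - σ⁻¹ = q - q⁻¹`. It is stated as an action on `Y` because the algebra is not
known to be nontrivial. -/
theorem Qp_sub_Qm (hq : q ≠ 0) (n : ℕ) (Y : Alg q S (n + 1)) :
    (T.Qp - T.Qm) • Y = ((q - q⁻¹) * T.Q0) • Y := by
  have h1 := T.tr_sigma n 1 Y
  have h2 := T.tr_sigma_inv n 1 Y
  rw [inverse_sigma hq ⟨by omega, by omega⟩] at h2
  simp only [map_one, one_mul] at h1 h2
  rw [sub_smul T.Qp T.Qm Y, ← h1, ← h2, ← map_sub, ← sub_mul, sub_sub_cancel, smul_mul_assoc,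
    one_mul, map_smul, T.tr_incl, smul_smul]

theorem iter_row_mul (k m r : ℕ) (hr : r + 1 ≤ m) (Y : Alg q S (k + m)) :
    T.iter k m (sigmaRow (sigmaSeq q S (k + m) k) r * Y) =
      T.iter k m (Y * sigmaRow (sigmaSeq q S (k + m) k) r) := by
  induction r generalizing Y with
  | zero => simp [sigmaRow]
  | succ r ih =>
    rw [sigmaRow, mul_assoc, ih (by omega), mul_assoc, iter_sigma_mul T k m r (by omega)]
    simp only [mul_assoc]

/-- Cyclicity is available one generator at a time; it extends to products and sums of generators,
which is all the proof needs. -/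
theorem iter_cosetSum_mul (α : ℂ) (k m r : ℕ) (hr : r + 2 ≤ m) (Y : Alg q S (k + m)) :
    T.iter k m (cosetSum α (fun i => sigmaSeq q S (k + m) k (i + 1)) r * Y) =
      T.iter k m (Y * cosetSum α (fun i => sigmaSeq q S (k + m) k (i + 1)) r) := by
  induction r generalizing Y with
  | zero => simp [cosetSum]
  | succ r ih =>
    rw [cosetSum, add_mul, mul_add, map_add, map_add, smul_mul_assoc, mul_smul_comm, mul_assoc,
      ih (by omega), mul_assoc, iter_sigma_mul T k m (r + 1) (by omega)]
    simp only [mul_assoc, mul_one, one_mul]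

end MarkovTrace

theorem transfer_one (T : MarkovTrace q S) (ξ : ℂ) (s : ℤˣ) (k : ℕ) (x : ℂ) :
    transfer T ξ s 1 (k + 1) x = T.tr k (baxTau q S ξ (k + 1) (k + 1) x) := by
  change T.tr k (barB q S ξ s (k + 1) 1 (k + 1) x) = _
  have hu : ∀ i, content q s (i + 1) = sub s q ^ (2 * i) := fun i => content_eq s i
  rw [barB, fusedB_eq (sub_sub_inv s) ξ _ _ _ _ _ hu]
  simp [idem, fusedProd, baxRow]

theorem eta_scalar {α Qp Qm Q0 x : ℂ} {m : ℕ} (h0 : α ≠ 0)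
    (hroot : ∀ n : ℕ, 0 < n → α ^ (2 * n) ≠ 1) (hQp : Qp ≠ 0)
    (hQ : Qp - Qm = (α - α⁻¹) * Q0) {P : ℂ}
    (hden : 1 - x ^ 2 * α ^ (2 * (m + 1)) * α ^ (2 * m) ≠ 0)
    (hP : P * (1 - x ^ 2 * α ^ (2 * (m + 1)) * α ^ (2 * (m + 1)) / α ^ 2) =
      α ^ (m + 1) * (1 - x ^ 2 * α ^ (2 * (m + 1)) / α ^ 2)) :
    α⁻¹ * qInt α (m + 1) * Qm * (α ^ m)⁻¹ +
      (P - (α ^ (m + 1))⁻¹) * (Qp * qInt α (m + 1) + (α ^ (m + 1))⁻¹ * Q0) =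
    etaBase Qp (Qp / Qm) α (m + 1) x := by
  have h1 := pow_sub_inv_ne_zero h0 hroot (n := 1) one_pos
  rw [pow_one] at h1
  have hα2 : α ^ 2 - 1 ≠ 0 := by
    intro h; apply h1; field_simp; rw [h, mul_zero]
  have hQ0 : Q0 = (Qp - Qm) / (α - α⁻¹) := by rw [hQ]; field_simp
  have hd : 1 - x ^ 2 * α ^ (2 * (m + 1)) * α ^ (2 * (m + 1)) / α ^ 2 =
      1 - x ^ 2 * α ^ (2 * (m + 1)) * α ^ (2 * m) := by
    field_simp
    ring
  rw [hd] at hP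
  have hP' := eq_div_of_mul_eq hden hP
  have hd2 : α ^ 2 - α ^ (4 * (m + 1)) * x ^ 2 =
      α ^ 2 * (1 - x ^ 2 * α ^ (2 * (m + 1)) * α ^ (2 * m)) := by ring
  rw [etaBase, hd2, hP', hQ0, qInt, div_div_eq_mul_div]
  have e1 : α ^ (2 * (m + 1)) = α ^ (2 * m) * α ^ 2 := by ring
  have e2 : α ^ (2 * m) = (α ^ m) ^ 2 := by ring
  have e3 : α ^ (m + 1) = α ^ m * α := by ring
  have ha : α ^ m ≠ 0 := pow_ne_zero _ h0
  obtain ⟨D, hD⟩ : ∃ D, D = 1 - x ^ 2 * α ^ (2 * (m + 1)) * α ^ (2 * m) := ⟨_, rfl⟩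
  rw [← hD] at hden ⊢
  rw [e1, e2] at hD ⊢
  rw [e3]
  generalize α ^ m = a at *
  field_simp
  rw [hD]
  ring

end Trace

/-! ### Evaluation of the trace -/

section Abstract

variable {A B V : Type*} [Ring A] [Algebra ℂ A] [Ring B] [Algebra ℂ B] [AddCommGroup V]
  [Module ℂ V]

/-- The partial trace `tr` over the last strand followed by a trace `Ψ`, evaluated on the product
of the symmetrizer, an absorbing element, a row of Baxterized generators and `f t`. -/
theorem trace_symmetrizer_mul_baxRow {α Qp Qm Q0 : ℂ} (h0 : α ≠ 0)
    (h1 : α - α⁻¹ ≠ 0) {m : ℕ} {σ : ℕ → A} {ρ : ℕ → B} (hσ : IsHeckeSeq α (m + 1) σ)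
    (f : B →ₐ[ℂ] A) (hf : ∀ i < m, f (ρ i) = σ i) (tr : A →ₗ[ℂ] B) (Ψ : B →ₗ[ℂ] V)
    (tr_f : ∀ X, tr (f X) = Q0 • X)
    (tr_sigma : ∀ X X', tr (f X * σ m * f X') = Qp • (X * X'))
    (tr_sigma_inv : ∀ X X', tr (f X * (σ m - (α - α⁻¹) • 1) * f X') = Qm • (X * X'))
    (cyc : ∀ i < m + 1, ∀ Y, Ψ (tr (σ i * Y)) = Ψ (tr (Y * σ i)))
    (cyc_row : ∀ Y, Ψ (tr (sigmaRow σ (m + 1) * Y)) = Ψ (tr (Y * sigmaRow σ (m + 1))))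
    (cyc_coset : ∀ Y, Ψ (tr (cosetSum α (fun i => σ (i + 1)) m * Y)) =
      Ψ (tr (Y * cosetSum α (fun i => σ (i + 1)) m)))
    {E : A} (hE : ∀ i < m + 1, σ i * E = α • E) {c : ℂ} {W t : B}
    (hEW : E * f W = c • (cosetSum α σ (m + 1) * f W))
    (hWl : ∀ i < m, ρ i * W = α • W) (hWr : ∀ i < m, W * ρ i = α • W)
    (ht : ∀ i, 1 ≤ i → i < m + 1 → Commute (σ i) (f t)) {z : ℂ}
    (hz : ∀ k < m + 1, z * α ^ (2 * k) ≠ 1) :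
    Ψ (tr (E * (f W * baxRow α σ (m + 1) z) * f t)) =
      c • (Ψ (tr (f W * (sigmaRowInv α σ (m + 1) * f t * sigmaRow σ (m + 1)))) +
        (α⁻¹ * qInt α (m + 1) * Qm * (α ^ m)⁻¹ +
          (rowEval α (m + 1) z - (α ^ (m + 1))⁻¹) *
            (Qp * qInt α (m + 1) + (α ^ (m + 1))⁻¹ * Q0)) • Ψ (W * t)) := by
  have hfWr : ∀ i < m, f W * σ i = α • f W := fun i hi => by
    rw [← hf i hi, ← map_mul, hWr i hi, map_smul]
  have htc : Commute (f t) (cosetSum α (fun i => σ (i + 1)) m) :=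
    commute_cosetSum fun i hi => (ht (i + 1) (by omega) (by omega)).symm
  let φ : A →ₗ[ℂ] V := Ψ ∘ₗ tr ∘ₗ LinearMap.mulRight ℂ (f t) ∘ₗ LinearMap.mulLeft ℂ E
  have φ_apply : ∀ Z, φ Z = Ψ (tr (E * Z * f t)) := fun Z => rfl
  -- For `i ≥ 1`, `σ i` commutes with `f t`, cycles round to the left end and is absorbed by `E`.
  have hφ : ∀ Z i, 1 ≤ i → i < m + 1 → φ (Z * (σ i - (α - α⁻¹) • 1)) = α⁻¹ • φ Z := by
    intro Z i hi him
    have e1 : E * (Z * (σ i - (α - α⁻¹) • 1)) * f t =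
        E * Z * f t * σ i - (α - α⁻¹) • (E * Z * f t) := by
      have := (ht i hi him).eq
      simp only [mul_sub, sub_mul, mul_smul_comm, smul_mul_assoc, mul_one, mul_assoc, this]
    rw [φ_apply, φ_apply, e1, map_sub, map_sub, ← cyc i him, mul_assoc E, ← mul_assoc (σ i), hE i him,
      smul_mul_assoc]
    simp only [map_smul]
    module
  have h := map_baxRow_sub h0 hσ φ hφ le_rfl (W := f W) (fun i hi => hfWr i (by omega)) hz
  -- In the coset sum only the last generator `σ m` meets the partial trace: it yields `Q_+`, and
  -- the summand without it yields `Q_0`.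
  have p1 : φ (f W) = c • ((Qp * qInt α (m + 1) + (α ^ (m + 1))⁻¹ * Q0) • Ψ (W * t)) := by
    have e1 : E * f W * f t = c • (f (cosetSum α ρ m) * σ m * f (W * t) +
        (α ^ (m + 1))⁻¹ • f (W * t)) := by
      rw [hEW, cosetSum, map_cosetSum f hf, map_mul]
      simp only [add_mul, smul_mul_assoc, one_mul, mul_assoc]
    rw [φ_apply, e1, map_smul, map_add, tr_sigma, map_smul tr, tr_f, ← mul_assoc,
      cosetSum_mul_of_absorb h0 h1 hWl, smul_mul_assoc]
    simp only [map_smul, map_add]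
    module
  have p2 : φ (f W * sigmaRowInv α σ (m + 1)) =
      c • (Ψ (tr (f W * (sigmaRowInv α σ (m + 1) * f t * sigmaRow σ (m + 1)))) +
        (α⁻¹ * qInt α (m + 1) * Qm * (α ^ m)⁻¹) • Ψ (W * t)) := by
    have e1 : E * (f W * sigmaRowInv α σ (m + 1)) * f t =
        c • (sigmaRow σ (m + 1) * (f W * sigmaRowInv α σ (m + 1) * f t) +
          α⁻¹ • (cosetSum α (fun i => σ (i + 1)) m *
            (f W * sigmaRowInv α σ (m + 1) * f t))) := by
      rw [← mul_assoc E, hEW, cosetSum_succ_eq]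
      simp only [add_mul, smul_mul_assoc, mul_assoc]
    -- The shifted coset sum commutes with `f t`, loses its shift on passing the inverse row, and is
    -- absorbed by `f W` with value `[m + 1]`.
    have e2 : f W * sigmaRowInv α σ (m + 1) * f t * cosetSum α (fun i => σ (i + 1)) m =
        qInt α (m + 1) • (f W * sigmaRowInv α σ (m + 1) * f t) := by
      rw [mul_assoc, htc.eq, ← mul_assoc, mul_assoc (f W), sigmaRowInv_mul_cosetSum hσ le_rfl
        (Nat.lt_succ_self m), ← mul_assoc (f W), mul_cosetSum_of_absorb h0 h1 hfWr,
        smul_mul_assoc, smul_mul_assoc]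
    have e3 : f W * sigmaRowInv α σ (m + 1) * f t =
        f W * (σ m - (α - α⁻¹) • 1) * f (sigmaRowInv α ρ m * t) := by
      rw [map_mul, map_sigmaRowInv f hf, sigmaRowInv]
      simp only [mul_assoc]
    have e4 : Ψ (tr (f W * sigmaRowInv α σ (m + 1) * f t)) =
        (Qm * (α ^ m)⁻¹) • Ψ (W * t) := by
      rw [e3, tr_sigma_inv, ← mul_assoc, mul_sigmaRowInv_of_absorb hWr, smul_mul_assoc, smul_smul,
        map_smul]
    rw [φ_apply, e1]
    simp only [map_smul, map_add]
    rw [cyc_row, cyc_coset, e2]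
    simp only [map_smul]
    rw [e4]
    simp only [mul_assoc]
    module
  rw [← φ_apply, h, p1, p2]
  module

end Abstract

/-! ### Absorption by the fused operators and the fusion formula -/

variable {q : ℂ} {S : Set ℂ}

theorem barB_eq (ξ : ℂ) (s : ℤˣ) (n m k : ℕ) (x : ℂ) :
    barB q S ξ s n (m + 1) (k + 1) x = symmetrizer (sub s q) (sigmaSeq q S n k) m *
      fusedProd (sub s q) (sigmaSeq q S n k) (baxTau q S ξ n (k + 1)) x (m + 1) := by
  rw [barB, idem_eq, fusedB_eq (sub_sub_inv s) ξ _ _ _ _ _ (content_eq s)]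

theorem sub_sq_ne_neg_one (hroot : ∀ n : ℕ, 0 < n → q ^ n ≠ 1) (s : ℤˣ) : sub s q ^ 2 ≠ -1 := by
  intro h
  have := sub_pow_ne_one hroot s (n := 4) (by omega)
  rw [show 4 = 2 * 2 from rfl, pow_mul, h] at this
  norm_num at this

theorem sigmaSeq_mul_barB (hq : q ≠ 0) (ξ : ℂ) (s : ℤˣ) {n m k : ℕ} (hn : k + m < n) (x : ℂ)
    {i : ℕ} (hi : i < m) :
    sigmaSeq q S n k i * barB q S ξ s n (m + 1) (k + 1) x =
      sub s q • barB q S ξ s n (m + 1) (k + 1) x := by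
  rw [barB_eq, ← mul_assoc, sigma_mul_symmetrizer (sub_ne_zero_of_ne_zero hq s)
    (isHeckeSeq_sigmaSeq hq (sub_sub_inv s) hn) le_rfl hi, smul_mul_assoc]

theorem barB_mul_sigmaSeq (hq : q ≠ 0) (hroot : ∀ n : ℕ, 0 < n → q ^ n ≠ 1) (ξ : ℂ) (s : ℤˣ)
    {n m k : ℕ} (hn : k + m < n) {x : ℂ} (hx : x ≠ 0)
    (hX : ∀ i l, l < i → i < m + 1 → x ^ 2 * sub s q ^ (2 * i) * sub s q ^ (2 * l) ≠ 1)
    (hXτ : 1 ≤ k → ∀ i < m + 1, x * sub s q ^ (2 * i) ≠ 1)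
    (hτ : ∀ i < m + 1, ξ * (x * sub s q ^ (2 * i))⁻¹ ∈ insert 0 S) {i : ℕ} (hi : i < m) :
    barB q S ξ s n (m + 1) (k + 1) x * sigmaSeq q S n k i =
      sub s q • barB q S ξ s n (m + 1) (k + 1) x := by
  have h0 := sub_ne_zero_of_ne_zero hq s
  have hα := sub_sub_inv (q := q) s
  have hσ := isHeckeSeq_sigmaSeq (S := S) hq hα hn
  have h1 := sub_pow_ne_one hroot s (n := 2) two_pos
  rw [barB_eq]
  refine absorb_fusedProd (m := m + 1) h0 h1 (sub_sq_ne_neg_one hroot s) hσ hx hX ?_ ?_ ?_ (by omega)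
  · intro i _ l hl hl'
    exact commute_sigma_baxTau ξ (by omega) (by omega) _
  · intro i hi
    refine reflection hq hα (by omega) (mul_ne_zero hx (pow_ne_zero _ h0))
      (mul_ne_zero hx (pow_ne_zero _ h0)) (fun hk => hXτ hk i (by omega))
      (fun hk => hXτ hk (i + 1) hi) ?_ ?_ (hτ i (by omega)) (hτ (i + 1) hi)
    · intro h
      apply h1
      have h2 : x * sub s q ^ (2 * i) ≠ 0 := mul_ne_zero hx (pow_ne_zero _ h0)
      rw [mul_add, pow_add, ← mul_assoc] at h
      exact (mul_right_eq_self₀.1 h.symm).resolve_right h2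
    · have := hX (i + 1) i (by omega) hi
      intro h
      apply this
      rw [← h]
      ring
  · intro i hi
    exact symmetrizer_mul_sigma h0 hσ le_rfl (by omega)

theorem incl_barB {ξ : ℂ} {s : ℤˣ} {n m k : ℕ} (hn : k + m < n) {x : ℂ}
    (hτ : ∀ i < m + 1, ξ * (x * sub s q ^ (2 * i))⁻¹ ∈ insert 0 S) :
    incl q S n (barB q S ξ s n (m + 1) (k + 1) x) = barB q S ξ s (n + 1) (m + 1) (k + 1) x := by
  rw [barB_eq, barB_eq, map_mul,
    map_symmetrizer (incl q S n) (fun i hi => incl_sigmaSeq (by omega)),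
    map_fusedProd (incl q S n) (fun i hi => incl_sigmaSeq (by omega))
      (fun i hi => incl_baxTau (by omega) (by omega) (hτ i hi))]

theorem transfer_fusion (hq : q ≠ 0) (hroot : ∀ n : ℕ, 0 < n → q ^ n ≠ 1) (ξ : ℂ)
    (T : MarkovTrace q S) (hQp : T.Qp ≠ 0) (s : ℤˣ) (m k : ℕ) {x : ℂ} (hx : x ≠ 0)
    (hX : ∀ i l, l < i → i < m + 2 → x ^ 2 * sub s q ^ (2 * i) * sub s q ^ (2 * l) ≠ 1)
    (hXτ : 1 ≤ k → ∀ i < m + 2, x * sub s q ^ (2 * i) ≠ 1)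
    (hτ : ∀ i < m + 2, ξ * (x * sub s q ^ (2 * i))⁻¹ ∈ insert 0 S) :
    transfer T ξ s (m + 2) (k + 1) x =
      (qInt (sub s q) (m + 2))⁻¹ •
        (transfer T ξ s (m + 1) (k + 1) x *
            transfer T ξ s 1 (k + 1) (x * sub s q ^ (2 * (m + 1))) +
          eta T s (m + 1) x •
            transferExt T ξ s (m + 1) (k + 1) x (x * sub s q ^ (2 * (m + 1)))) := by
  set α := sub s q with hαdef
  have h0 : α ≠ 0 := sub_ne_zero_of_ne_zero hq s
  have hα : α - α⁻¹ = q - q⁻¹ := sub_sub_inv s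
  have hroot' : ∀ n : ℕ, 0 < n → α ^ (2 * n) ≠ 1 := fun n hn =>
    sub_pow_ne_one hroot s (by omega)
  have h1 := pow_sub_inv_ne_zero h0 hroot' (n := 1) one_pos
  rw [pow_one] at h1
  have hσ := isHeckeSeq_sigmaSeq (S := S) (n := k + (m + 1) + 1) (k := k) (N := m + 1) hq hα
    (by omega)
  set y := x * α ^ (2 * (m + 1)) with hy
  set n := k + (m + 1) with hn
  set W := barB q S ξ s n (m + 1) (k + 1) x with hW
  set t := baxTau q S ξ n (k + 1) y with ht
  have hft : incl q S n t = baxTau q S ξ (n + 1) (k + 1) y :=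
    incl_baxTau (by omega) (by omega) (hτ (m + 1) (by omega))
  have hfW : incl q S n W = barB q S ξ s (n + 1) (m + 1) (k + 1) x :=
    incl_barB (by omega) fun i hi => hτ i (by omega)
  set E := symmetrizer α (sigmaSeq q S (n + 1) k) (m + 1) with hE
  have hEabs : E * symmetrizer α (sigmaSeq q S (n + 1) k) m = E :=
    mul_symmetrizer_of_absorb h0 hroot' fun i hi => symmetrizer_mul_sigma h0 hσ le_rfl (by omega)
  have hbar : barB q S ξ s (n + 1) (m + 2) (k + 1) x =
      E * (incl q S n W * baxRow α (sigmaSeq q S (n + 1) k) (m + 1) (x ^ 2 * α ^ (2 * (m + 1)))) *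
        incl q S n t := by
    rw [hfW, hft, barB_eq, barB_eq, ← mul_assoc E, ← mul_assoc E, hEabs, fusedProd]
    simp only [mul_assoc]
    rfl
  have hEW : E * incl q S n W = (qInt α (m + 2))⁻¹ •
      (cosetSum α (sigmaSeq q S (n + 1) k) (m + 1) * incl q S n W) := by
    rw [hfW, barB_eq, ← mul_assoc, hEabs, hE, symmetrizer_succ h0 hroot' hσ (by omega),
      smul_mul_assoc, mul_assoc]
  have key := trace_symmetrizer_mul_baxRow (Qp := T.Qp) (Qm := T.Qm) (Q0 := T.Q0) h0 h1
    (m := m) (ρ := sigmaSeq q S n k) hσ (incl q S n) (fun i hi => incl_sigmaSeq (by omega))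
    (T.tr n) (T.iter k (m + 1)) (T.tr_incl n) (T.tr_sigma (k + m))
    (fun X X' => by
      have := T.tr_sigma_inv (k + m) X X'
      rw [inverse_sigma hq ⟨by omega, by omega⟩, ← hα] at this
      exact this)
    (fun i hi Y => T.iter_sigma_mul k (m + 2) i (by omega) Y)
    (fun Y => T.iter_row_mul k (m + 2) (m + 1) le_rfl Y)
    (fun Y => T.iter_cosetSum_mul α k (m + 2) m le_rfl Y)
    (E := E) (fun i hi => sigma_mul_symmetrizer h0 hσ le_rfl hi) (W := W) (t := t) hEW
    (fun i hi => sigmaSeq_mul_barB hq ξ s (by omega) x hi)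
    (fun i hi => barB_mul_sigmaSeq hq hroot ξ s (by omega) hx
      (fun i l hl hi => hX i l hl (by omega)) (fun hk i hi => hXτ hk i (by omega))
      (fun i hi => hτ i (by omega)) hi)
    (fun i h hi => by rw [hft]; exact commute_sigma_baxTau ξ (by omega) (by omega) _)
    (z := x ^ 2 * α ^ (2 * (m + 1))) (fun l hl => hX (m + 1) l hl (by omega))
  have hrow := T.tr_conj_row hq hα (k := k) (m := m + 1)
    (fun n => if k < n then baxTau q S ξ n (k + 1) y else 0) (fun l hl => by
      rw [if_pos hl, if_pos (by omega)]
      exact incl_baxTau (by omega) (by omega) (hτ (m + 1) (by omega)))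
  rw [if_pos (by omega), if_pos (by omega)] at hrow
  have hprod : T.iter k (m + 1) (T.tr n (incl q S n W *
      (sigmaRowInv α (sigmaSeq q S (n + 1) k) (m + 1) * incl q S n t *
        sigmaRow (sigmaSeq q S (n + 1) k) (m + 1)))) =
      transfer T ξ s (m + 1) (k + 1) x * transfer T ξ s 1 (k + 1) y := by
    rw [T.tr_incl_mul, hft, hrow, T.iter_mul_inclIter, transfer_one]
    rfl
  have htop : transfer T ξ s (m + 2) (k + 1) x =
      T.iter k (m + 1) (T.tr n (barB q S ξ s (n + 1) (m + 2) (k + 1) x)) := rfl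
  have hext : transferExt T ξ s (m + 1) (k + 1) x y = T.iter k (m + 1) (W * t) := rfl
  rw [htop, hbar, key, hprod, hext]
  congr 2
  -- The scalar relation between `Q_+`, `Q_-` and `Q_0` can be read off only from its action on a
  -- nonzero vector; if this one vanishes, the coefficient is irrelevant.
  by_cases hv : T.iter k (m + 1) (W * t) = 0
  · rw [hv]
    exact (smul_zero _).trans (smul_zero _).symm
  congr 1
  have hQ : T.Qp - T.Qm = (α - α⁻¹) * T.Q0 := by
    have := congrArg (T.iter k (m + 1)) (T.Qp_sub_Qm hq (k + m) (W * t))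
    rw [map_smul, map_smul] at this
    rw [hα]
    exact smul_left_injective ℂ hv this
  have hP := rowEval_mul h0 (m := m + 1) (z := x ^ 2 * α ^ (2 * (m + 1)))
    fun l hl => hX (m + 1) l hl (by omega)
  exact eta_scalar h0 hroot' hQp hQ
    (sub_ne_zero.2 (hX (m + 1) m (by omega) (by omega)).symm) hP

end AffineHecke

theorem theorem5p2 (q : ℂ) (hq : q ≠ 0) (hroot : ∀ n : ℕ, 0 < n → q ^ n ≠ 1)
    (S : Set ℂ) (ξ : ℂ) (T : AffineHecke.MarkovTrace q S) (hQp : T.Qp ≠ 0) (hQm : T.Qm ≠ 0)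
    (s : ℤˣ) (m : ℕ) (hm : 2 ≤ m) (j : ℕ) (hj : 1 ≤ j) (x : ℂ) (hx : x ≠ 0)
    -- the spectral parameters stay away from the poles
    (hX : ∀ i k : ℕ, 1 ≤ i → i < k → k ≤ m →
      x ^ 2 * AffineHecke.content q s i * AffineHecke.content q s k ≠ 1)
    (hXτ : 2 ≤ j → ∀ i : ℕ, 1 ≤ i → i ≤ m → x * AffineHecke.content q s i ≠ 1)
    (hτ : ∀ i : ℕ, 1 ≤ i → i ≤ m → ξ * (x * AffineHecke.content q s i)⁻¹ ∈ insert 0 S) :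
    AffineHecke.transfer T ξ s m j x =
      (AffineHecke.qInt (((s : ℤ) : ℂ) * q) m)⁻¹ •
        (AffineHecke.transfer T ξ s (m - 1) j x *
            AffineHecke.transfer T ξ s 1 j (x * AffineHecke.content q s m) +
          AffineHecke.eta T s (m - 1) x •
            AffineHecke.transferExt T ξ s (m - 1) j x (x * AffineHecke.content q s m)) := by
  obtain ⟨k, rfl⟩ : ∃ k, j = k + 1 := ⟨j - 1, by omega⟩
  obtain ⟨m, rfl⟩ : ∃ l, m = l + 2 := ⟨m - 2, by omega⟩
  have hc := AffineHecke.content_eq (q := q) s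
  have h := AffineHecke.transfer_fusion hq hroot ξ T hQp s m k hx
    (fun i l hl hi => by
      have := hX (l + 1) (i + 1) (by omega) (by omega) (by omega)
      rw [hc, hc] at this
      rwa [mul_right_comm])
    (fun hk i hi => by
      have := hXτ (by omega) (i + 1) (by omega) (by omega)
      rwa [hc] at this)
    (fun i hi => by
      have := hτ (i + 1) (by omega) (by omega)
      rwa [hc] at this)
  rw [AffineHecke.qInt_sub, h, ← hc]
  rfl
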